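/- Let $(\Omega,\Sigma,\mu)$ be a measure space and let $\mathcal M$ be the set of $\mu$-a.e. strictly positive measurable functions $p$ with $\int_\Omega p\,d\mu=1$, functions equal $\mu$-a.e. being identified. Let $\Phi_1(x)=\cosh x-1$, with complementary Young function $\Psi_1(y)=\int_0^{|y|}\operatorname{arsinh}(s)\,ds$. For $p\in\mathcal M$ let $M^{\Phi_1}(p)$ be the space of random variables $u$ (modulo a.e. equality) with $\int_\Omega\Phi_1(ku)\,p\,d\mu<\infty$ for all $k>0$, with the Orlicz norm $$\|u\|_{\Phi_1,p}=\sup\Big\{\int_\Omega|ug|\,p\,d\mu:\ g \text{ measurable},\ \int_\Omega\Psi_1(g)\,p\,d\mu\le1\Big\},$$ and let $B_p=\{u\in M^{\Phi_1}(p):\int_\Omega u\,p\,d\mu=0\}$, with open unit ball $\mathcal V_p$. Put $Z_p(u)=\int_\Omega e^u\,p\,d\mu$, $e_p(u)=\dfrac{e^u}{Z_p(u)}\,p$ for $u\in\mathcal V_p$, and $\mathcal U_p=e_p(\mathcal V_p)$. Then $e_p:\mathcal V_p\to\mathcal U_p$ is a bijection, with inverse $e_p^{-1}(q)=\log(q/p)-\int_\Omega\log(q/p)\,p\,d\mu$,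 and: 1. $\{(\mathcal U_p,e_p^{-1}):p\in\mathcal M\}$ is a $C^\infty$ atlas on $\mathcal M$: every $B_p$ is a Banach space, the sets $\mathcal U_p$ cover $\mathcal M$, the sets $e_p^{-1}(\mathcal U_p)=\mathcal V_p$ and $e_{p_1}^{-1}(\mathcal U_{p_1}\cap\mathcal U_{p_2})$ are open in $B_p$ and $B_{p_1}$ respectively, and every transition map $e_{p_2}^{-1}\circ e_{p_1}:e_{p_1}^{-1}(\mathcal U_{p_1}\cap\mathcal U_{p_2})\to e_{p_2}^{-1}(\mathcal U_{p_1}\cap\mathcal U_{p_2})$ is of class $C^\infty$, as is its inverse. 2. Give $\mathcal M$ the topology defined by this atlas. For every $p\in\mathcal M$ the connected component $\mathcal C$ of $p$ is open and is a $C^\infty$ Banach manifold modelled on $B_p$: every $\mathcal U_q$ that meets $\mathcal C$ lies in $\mathcal C$, for these $q$ the space $B_q$ is toplinearly isomorphic to $B_p$, and the charts $e_q^{-1}$, composed with toplinear isomorphisms $B_q\to B_p$, form a $C^\infty$ atlas of $\mathcal C$ with values in $B_p$. 3. If in addition $(\Omega,\Sigma,\mu)$ is separable (some countable family of measurable sets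 approximates every set of finite measure in measure) and $\mu$ is diffuse on some measurable set of positive measure (no measurable subset of it is an atom), then all the spaces $B_q$, $q\in\mathcal M$, are toplinearly isomorphic, and for every $p$ the whole of $\mathcal M$ is, in the same sense, a $C^\infty$ Banach manifold modelled on $B_p$. -/

import Mathlib

open MeasureTheory Set
open scoped ENNReal

noncomputable section

namespace InfoGeom

/-! ### The exponential Young function and its complementary function -/

/-- The Young function `Φ₁(x) = cosh x - 1`. -/
def Φ₁ (x : ℝ) : ℝ := Real.cosh x - 1

/-- The generalised inverse `s ↦ inf {t ≥ 0 : φ(t) > s}` of a function on `[0, ∞)`. -/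
def genInv (φ : ℝ → ℝ) (s : ℝ) : ℝ := sInf {t : ℝ | 0 ≤ t ∧ s < φ t}

/-- The Young function complementary to `Φ₁(x) = ∫₀^{|x|} sinh t dt`. -/
def Ψ₁ (y : ℝ) : ℝ := ∫ s in (0 : ℝ)..|y|, genInv Real.sinh s

/-- `Φ₁` is the Young function with density `sinh`. -/
theorem Φ₁_eq_integral (x : ℝ) : Φ₁ x = ∫ t in (0 : ℝ)..|x|, Real.sinh t := by
  rw [intervalIntegral.integral_eq_sub_of_hasDerivAt (fun t _ => Real.hasDerivAt_cosh t)
    (Real.continuous_sinh.intervalIntegrable _ _), Real.cosh_abs, Real.cosh_zero, Φ₁]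

theorem genInv_sinh {s : ℝ} (hs : 0 ≤ s) : genInv Real.sinh s = Real.arsinh s := by
  have : {t : ℝ | 0 ≤ t ∧ s < Real.sinh t} = Ioi (Real.arsinh s) := by
    ext t
    have h : s < Real.sinh t ↔ Real.arsinh s < t := by
      rw [← Real.sinh_lt_sinh (x := Real.arsinh s), Real.sinh_arsinh]
    simp only [mem_ofPred_eq, mem_Ioi, h]
    exact ⟨fun h => h.2, fun h => ⟨(Real.arsinh_nonneg_iff.2 hs).trans h.le, h⟩⟩
  rw [genInv, this, csInf_Ioi]

theorem Ψ₁_eq (y : ℝ) :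
    Ψ₁ y = |y| * Real.arsinh |y| - Real.sqrt (1 + |y| ^ 2) + 1 := by
  have h1 : Ψ₁ y = ∫ s in (0 : ℝ)..|y|, Real.arsinh s := by
    refine intervalIntegral.integral_congr fun s hs => genInv_sinh ?_
    rw [uIcc_of_le (abs_nonneg y)] at hs
    exact hs.1
  have h2 : ∀ x ∈ uIcc (0 : ℝ) |y|,
      HasDerivAt (fun x : ℝ => x * Real.arsinh x - Real.sqrt (1 + x ^ 2)) (Real.arsinh x) x := by
    intro x _
    have h0 : (1 + x ^ 2) ≠ 0 := by positivity
    have hs : Real.sqrt (1 + x ^ 2) ≠ 0 := by positivity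
    have ha := ((hasDerivAt_id x).mul (Real.hasDerivAt_arsinh x)).sub
      (((hasDerivAt_pow 2 x).const_add 1).sqrt h0)
    refine ha.congr_deriv ?_
    simp only [id]
    field_simp
    ring
  rw [h1, intervalIntegral.integral_eq_sub_of_hasDerivAt h2
    (Real.continuous_arsinh.intervalIntegrable _ _)]
  simp

theorem Φ₁_nonneg (x : ℝ) : 0 ≤ Φ₁ x := by
  have := Real.one_le_cosh x
  simp only [Φ₁]; linarith

theorem Φ₁_abs (x : ℝ) : Φ₁ |x| = Φ₁ x := by simp [Φ₁]

theorem Φ₁_le_Φ₁ {x y : ℝ} (h : |x| ≤ |y|) : Φ₁ x ≤ Φ₁ y := by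
  have := Real.cosh_le_cosh.2 h
  simp only [Φ₁]; linarith

theorem continuous_Φ₁ : Continuous Φ₁ := by
  unfold Φ₁; fun_prop

theorem continuous_Ψ₁ : Continuous Ψ₁ := by
  have : Ψ₁ = fun y => |y| * Real.arsinh |y| - Real.sqrt (1 + |y| ^ 2) + 1 := funext Ψ₁_eq
  rw [this]
  exact ((continuous_abs.mul (Real.continuous_arsinh.comp continuous_abs)).sub
    (by fun_prop)).add continuous_const

/-- Young's inequality. -/
theorem young (x y : ℝ) : |x * y| ≤ Φ₁ x + Ψ₁ y := by
  have key : ∀ a t : ℝ, a * Real.sinh t ≤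
      Real.cosh a - 1 + (Real.sinh t * t - Real.cosh t + 1) := by
    intro a t
    have e1 : Real.cosh a = Real.cosh (a - t) * Real.cosh t + Real.sinh (a - t) * Real.sinh t := by
      rw [← Real.cosh_add]; congr 1; ring
    rw [e1]
    rcases le_total 0 t with ht | ht
    · have h1 := Real.cosh_sub_sinh (a - t)
      have h2 := Real.add_one_le_exp (-(a - t))
      have h3 := Real.cosh_sub_sinh t
      have h4 := Real.sinh_nonneg_iff.2 ht
      have h5 := Real.add_one_le_exp (a - t)
      have h6 := Real.cosh_add_sinh (a - t)
      have h7 := Real.one_le_cosh (a - t)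
      have h8 := Real.exp_pos (-t)
      nlinarith [mul_nonneg h8.le (sub_nonneg.2 h7), mul_nonneg h4 (sub_nonneg.2 h5)]
    · have h1 := Real.cosh_sub_sinh (a - t)
      have h2 := Real.add_one_le_exp (-(a - t))
      have h3 := Real.cosh_add_sinh t
      have h4 := Real.sinh_nonpos_iff.2 ht
      have h5 := Real.add_one_le_exp (a - t)
      have h6 := Real.cosh_add_sinh (a - t)
      have h7 := Real.one_le_cosh (a - t)
      have h8 := Real.exp_pos t
      nlinarith [mul_nonneg h8.le (sub_nonneg.2 h7), mul_nonneg (neg_nonneg.2 h4) (sub_nonneg.2 h2)]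
  have := key |x| (Real.arsinh |y|)
  rw [Real.sinh_arsinh, Real.cosh_arsinh] at this
  rw [Ψ₁_eq, abs_mul, Φ₁, ← Real.cosh_abs]
  linarith

variable {Ω : Type*} [MeasurableSpace Ω]

/-! ### The Orlicz norm -/

/-- The Orlicz norm (with values in `[0, ∞]`) associated with `Φ₁` over the measure `ν`:
`sup {∫ |f g| dν : ∫ Ψ₁(g) dν ≤ 1}`. -/
def orliczENorm (ν : Measure Ω) (f : Ω → ℝ) : ℝ≥0∞ :=
  ⨆ (g : Ω → ℝ) (_ : Measurable g ∧ ∫⁻ x, ENNReal.ofReal (Ψ₁ (g x)) ∂ν ≤ 1),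
    ∫⁻ x, ENNReal.ofReal |f x * g x| ∂ν

theorem orliczENorm_congr {ν : Measure Ω} {f f' : Ω → ℝ} (h : f =ᵐ[ν] f') :
    orliczENorm ν f = orliczENorm ν f' := by
  unfold orliczENorm
  refine iSup_congr fun g => iSup_congr fun _ => lintegral_congr_ae ?_
  filter_upwards [h] with x hx
  rw [hx]

theorem orliczENorm_add_le {ν : Measure Ω} {f f' : Ω → ℝ} (hf : AEMeasurable f ν) :
    orliczENorm ν (f + f') ≤ orliczENorm ν f + orliczENorm ν f' := by
  refine iSup₂_le fun g hg => ?_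
  calc ∫⁻ x, ENNReal.ofReal |(f + f') x * g x| ∂ν
      ≤ ∫⁻ x, (ENNReal.ofReal |f x * g x| + ENNReal.ofReal |f' x * g x|) ∂ν := by
        refine lintegral_mono fun x => ?_
        rw [← ENNReal.ofReal_add (abs_nonneg _) (abs_nonneg _)]
        refine ENNReal.ofReal_le_ofReal ?_
        rw [Pi.add_apply, add_mul]
        exact abs_add_le _ _
    _ = _ := lintegral_add_left' (by
        have := hf.mul hg.1.aemeasurable
        exact (this.norm).ennreal_ofReal) _
    _ ≤ _ := by
        gcongr
        · exact le_iSup₂_of_le g hg le_rfl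
        · exact le_iSup₂_of_le g hg le_rfl

theorem orliczENorm_smul {ν : Measure Ω} (c : ℝ) (f : Ω → ℝ) :
    orliczENorm ν (c • f) = ENNReal.ofReal |c| * orliczENorm ν f := by
  unfold orliczENorm
  simp only [ENNReal.mul_iSup]
  refine iSup_congr fun g => iSup_congr fun _ => ?_
  rw [← lintegral_const_mul' _ _ ENNReal.ofReal_ne_top]
  refine lintegral_congr fun x => ?_
  rw [← ENNReal.ofReal_mul (abs_nonneg _), ← abs_mul, Pi.smul_apply, smul_eq_mul, mul_assoc]

theorem orliczENorm_lt_top {ν : Measure Ω} {f : Ω → ℝ} (hf : AEMeasurable f ν)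
    (h : ∫⁻ x, ENNReal.ofReal (Φ₁ (f x)) ∂ν < ⊤) : orliczENorm ν f < ⊤ := by
  refine lt_of_le_of_lt (iSup₂_le fun g hg => ?_)
    (ENNReal.add_lt_top.2 ⟨h, ENNReal.one_lt_top⟩)
  calc ∫⁻ x, ENNReal.ofReal |f x * g x| ∂ν
      ≤ ∫⁻ x, (ENNReal.ofReal (Φ₁ (f x)) + ENNReal.ofReal (Ψ₁ (g x))) ∂ν :=
        lintegral_mono fun x =>
          (ENNReal.ofReal_le_ofReal (young _ _)).trans ENNReal.ofReal_add_le
    _ = ∫⁻ x, ENNReal.ofReal (Φ₁ (f x)) ∂ν + ∫⁻ x, ENNReal.ofReal (Ψ₁ (g x)) ∂ν :=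
        lintegral_add_left' (continuous_Φ₁.measurable.comp_aemeasurable hf).ennreal_ofReal _
    _ ≤ _ := by gcongr; exact hg.2

theorem ae_eq_zero_of_orliczENorm {ν : Measure Ω} [IsProbabilityMeasure ν] {f : Ω → ℝ}
    (hf : AEMeasurable f ν) (h : orliczENorm ν f = 0) : f =ᵐ[ν] 0 := by
  obtain ⟨c, hc, hc1⟩ : ∃ c : ℝ, 0 < c ∧ Ψ₁ c ≤ 1 := by
    have h0 : Ψ₁ 0 = 0 := by simp [Ψ₁]
    have : ∀ᶠ c in nhds (0 : ℝ), Ψ₁ c < 1 :=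
      continuous_Ψ₁.continuousAt.eventually (gt_mem_nhds (by rw [h0]; norm_num))
    obtain ⟨ε, hε, hb⟩ := Metric.eventually_nhds_iff.1 this
    refine ⟨ε / 2, by positivity, (hb ?_).le⟩
    rw [Real.dist_eq, sub_zero, abs_of_pos (by positivity)]
    linarith
  have h1 : ∫⁻ x, ENNReal.ofReal |f x * c| ∂ν = 0 := by
    refine le_antisymm ?_ bot_le
    rw [← h]
    refine le_iSup₂_of_le (fun _ => c) ⟨measurable_const, ?_⟩ le_rfl
    rw [lintegral_const, measure_univ, mul_one]
    exact ENNReal.ofReal_le_one.2 hc1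
  have hm : AEMeasurable (fun x => ENNReal.ofReal |f x * c|) ν :=
    ((hf.mul_const c).norm).ennreal_ofReal
  rw [lintegral_eq_zero_iff' hm] at h1
  filter_upwards [h1] with x hx
  have h2 : |f x * c| = 0 := le_antisymm (ENNReal.ofReal_eq_zero.1 hx) (abs_nonneg _)
  rcases mul_eq_zero.1 (abs_eq_zero.1 h2) with h3 | h3
  · exact h3
  · exact absurd h3 hc.ne'

/-! ### Strictly positive densities -/

variable {μ : Measure Ω}

/-- The set `𝓜(Ω, Σ, μ)` of `μ`-a.e. strictly positive probability densities with respect to `μ`;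
as usual, densities that agree `μ`-a.e. are identified. -/
@[ext] structure PosDensity (μ : Measure Ω) where
  toFun : Ω →ₘ[μ] ℝ
  pos : ∀ᵐ x ∂μ, 0 < toFun x
  integral_eq_one : ∫ x, toFun x ∂μ = 1

namespace PosDensity

/-- The probability measure `p dμ`. -/
def measure (p : PosDensity μ) : Measure Ω :=
  μ.withDensity fun x => ENNReal.ofReal (p.toFun x)

theorem integrable (p : PosDensity μ) : Integrable p.toFun μ := by
  by_contra h
  have := integral_undef h
  rw [p.integral_eq_one] at this
  exact one_ne_zero this

instance (p : PosDensity μ) : IsProbabilityMeasure p.measure := by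
  refine ⟨?_⟩
  rw [measure, withDensity_apply _ MeasurableSet.univ, Measure.restrict_univ,
    ← ofReal_integral_eq_lintegral_ofReal p.integrable (p.pos.mono fun _ h => h.le),
    p.integral_eq_one, ENNReal.ofReal_one]

theorem measure_ac (p : PosDensity μ) : p.measure ≪ μ := withDensity_absolutelyContinuous _ _

theorem ac_measure (p : PosDensity μ) : μ ≪ p.measure := by
  refine withDensity_absolutelyContinuous' p.toFun.aemeasurable.ennreal_ofReal ?_
  filter_upwards [p.pos] with x hx
  simpa using hx

theorem aemeasurable (p : PosDensity μ) (f : Ω →ₘ[μ] ℝ) : AEMeasurable f p.measure :=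
  f.aemeasurable.mono_ac p.measure_ac

end PosDensity

/-! ### The Banach spaces `M^{Φ₁}(p)` and `B_p` -/

/-- `M^{Φ₁}(p)`: the random variables `f` with `∫ Φ₁(k f) p dμ < ∞` for all `k > 0`, modulo equality
a.e. (the measures `p dμ` and `μ` have the same null sets). -/
def orliczHeart (p : PosDensity μ) : Submodule ℝ (Ω →ₘ[μ] ℝ) where
  carrier := {f | ∀ k : ℝ, 0 < k → ∫⁻ x, ENNReal.ofReal (Φ₁ (k * f x)) ∂p.measure < ⊤}
  add_mem' := by
    intro f g hf hg k hk
    have hm : AEMeasurable (fun x => ENNReal.ofReal (Φ₁ (2 * k * f x))) p.measure :=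
      (continuous_Φ₁.measurable.comp_aemeasurable
        ((p.aemeasurable f).const_mul (2 * k))).ennreal_ofReal
    refine lt_of_le_of_lt ?_ (ENNReal.add_lt_top.2
      ⟨hf (2 * k) (by positivity), hg (2 * k) (by positivity)⟩)
    rw [← lintegral_add_left' hm]
    refine lintegral_mono_ae ?_
    filter_upwards [p.measure_ac.ae_le (AEEqFun.coeFn_add f g)] with x hx
    rw [hx, Pi.add_apply, ← ENNReal.ofReal_add (Φ₁_nonneg _) (Φ₁_nonneg _)]
    refine ENNReal.ofReal_le_ofReal ?_
    rcases le_total |f x| |g x| with h | h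
    · have : Φ₁ (k * (f x + g x)) ≤ Φ₁ (2 * k * g x) := by
        refine Φ₁_le_Φ₁ ?_
        rw [abs_mul, abs_mul, abs_mul, abs_of_pos hk, abs_two]
        nlinarith [abs_add_le (f x) (g x)]
      linarith [Φ₁_nonneg (2 * k * f x)]
    · have : Φ₁ (k * (f x + g x)) ≤ Φ₁ (2 * k * f x) := by
        refine Φ₁_le_Φ₁ ?_
        rw [abs_mul, abs_mul, abs_mul, abs_of_pos hk, abs_two]
        nlinarith [abs_add_le (f x) (g x)]
      linarith [Φ₁_nonneg (2 * k * g x)]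
  zero_mem' := by
    intro k _
    have : ∫⁻ x, ENNReal.ofReal (Φ₁ (k * (0 : Ω →ₘ[μ] ℝ) x)) ∂p.measure = ∫⁻ _, 0 ∂p.measure := by
      refine lintegral_congr_ae ?_
      filter_upwards [p.measure_ac.ae_le (AEEqFun.coeFn_zero (β := ℝ) (μ := μ))] with x hx
      rw [hx]
      simp [Φ₁]
    rw [this, lintegral_zero]
    exact ENNReal.zero_lt_top
  smul_mem' := by
    intro c f hf k hk
    refine lt_of_le_of_lt ?_ (hf (k * (|c| + 1)) (by positivity))
    refine lintegral_mono_ae ?_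
    filter_upwards [p.measure_ac.ae_le (AEEqFun.coeFn_smul c f)] with x hx
    rw [hx, Pi.smul_apply, smul_eq_mul]
    refine ENNReal.ofReal_le_ofReal (Φ₁_le_Φ₁ ?_)
    rw [abs_mul, abs_mul, abs_mul, abs_mul, abs_of_pos (by positivity : 0 < |c| + 1), mul_assoc]
    gcongr
    linarith

theorem orliczENorm_heart_lt_top (p : PosDensity μ) (f : orliczHeart p) :
    orliczENorm p.measure f.1 < ⊤ :=
  orliczENorm_lt_top (p.aemeasurable f.1) (by simpa using f.2 1 one_pos)

theorem heart_coe_add (p : PosDensity μ) (f g : orliczHeart p) :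
    (f + g).1 =ᵐ[p.measure] (f.1 : Ω → ℝ) + g.1 := p.measure_ac.ae_le (AEEqFun.coeFn_add f.1 g.1)

theorem heart_coe_smul (p : PosDensity μ) (c : ℝ) (f : orliczHeart p) :
    (c • f).1 =ᵐ[p.measure] c • (f.1 : Ω → ℝ) := p.measure_ac.ae_le (AEEqFun.coeFn_smul c f.1)

theorem heart_coe_zero (p : PosDensity μ) :
    (0 : orliczHeart p).1 =ᵐ[p.measure] (0 : Ω → ℝ) :=
  p.measure_ac.ae_le (AEEqFun.coeFn_zero (β := ℝ) (μ := μ))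

/-- The Orlicz norm `‖·‖_{Φ₁,p}`. -/
instance (p : PosDensity μ) : Norm (orliczHeart p) :=
  ⟨fun f => (orliczENorm p.measure f.1).toReal⟩

theorem orliczHeart_norm_def (p : PosDensity μ) (f : orliczHeart p) :
    ‖f‖ = (orliczENorm p.measure f.1).toReal := rfl

theorem orliczHeart_core (p : PosDensity μ) : NormedSpace.Core ℝ (orliczHeart p) where
  norm_nonneg _ := ENNReal.toReal_nonneg
  norm_smul c f := by
    rw [orliczHeart_norm_def, orliczHeart_norm_def,
      orliczENorm_congr (heart_coe_smul p c f), orliczENorm_smul,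
      ENNReal.toReal_mul, ENNReal.toReal_ofReal (abs_nonneg _), Real.norm_eq_abs]
  norm_triangle f g := by
    rw [orliczHeart_norm_def, orliczHeart_norm_def, orliczHeart_norm_def,
      ← ENNReal.toReal_add (orliczENorm_heart_lt_top p f).ne (orliczENorm_heart_lt_top p g).ne]
    refine ENNReal.toReal_mono (ENNReal.add_lt_top.2
      ⟨orliczENorm_heart_lt_top p f, orliczENorm_heart_lt_top p g⟩).ne ?_
    rw [orliczENorm_congr (heart_coe_add p f g)]
    exact orliczENorm_add_le (p.aemeasurable f.1)
  norm_eq_zero_iff f := by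
    rw [orliczHeart_norm_def, ENNReal.toReal_eq_zero_iff]
    constructor
    · rintro (h | h)
      · refine Subtype.ext (AEEqFun.ext ?_)
        have h0 : (f.1 : Ω → ℝ) =ᵐ[μ] 0 :=
          p.ac_measure.ae_le (ae_eq_zero_of_orliczENorm (p.aemeasurable f.1) h)
        exact h0.trans (AEEqFun.coeFn_zero (β := ℝ) (μ := μ)).symm
      · exact absurd h (orliczENorm_heart_lt_top p f).ne
    · rintro rfl
      left
      rw [orliczENorm_congr (heart_coe_zero p)]
      simp [orliczENorm]

instance (p : PosDensity μ) : NormedAddCommGroup (orliczHeart p) :=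
  NormedAddCommGroup.ofCore (orliczHeart_core p)

instance (p : PosDensity μ) : NormedSpace ℝ (orliczHeart p) :=
  NormedSpace.ofCore (orliczHeart_core p)

theorem integrable_exp (p : PosDensity μ) (u : orliczHeart p) :
    Integrable (fun x => Real.exp (u.1 x)) p.measure := by
  have hm : AEMeasurable (fun x => Φ₁ (1 * u.1 x)) p.measure :=
    continuous_Φ₁.measurable.comp_aemeasurable ((p.aemeasurable u.1).const_mul 1)
  have hi : Integrable (fun x => Φ₁ (1 * u.1 x)) p.measure :=
    ⟨hm.aestronglyMeasurable, by
      rw [hasFiniteIntegral_iff_ofReal (Filter.Eventually.of_forall fun x => Φ₁_nonneg _)]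
      exact u.2 1 one_pos⟩
  refine ((hi.add (integrable_const 1)).const_mul 2).mono'
    (Real.measurable_exp.comp_aemeasurable (p.aemeasurable u.1)).aestronglyMeasurable
    (Filter.Eventually.of_forall fun x => ?_)
  have h1 := Real.cosh_eq (u.1 x)
  have h2 := Real.exp_pos (-(u.1 x))
  rw [Real.norm_eq_abs, Real.abs_exp]
  simp only [Pi.add_apply, Φ₁, one_mul]
  linarith

theorem integrable_heart (p : PosDensity μ) (u : orliczHeart p) : Integrable u.1 p.measure := by
  have h1 := integrable_exp p u
  have h2 := integrable_exp p (-u)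
  refine (h1.add h2).mono' (p.aemeasurable u.1).aestronglyMeasurable ?_
  filter_upwards [p.measure_ac.ae_le (AEEqFun.coeFn_neg u.1)] with x hx
  have e : Real.exp ((-u : orliczHeart p).1 x) = Real.exp (-(u.1 x)) := by
    rw [show (-u : orliczHeart p).1 = -u.1 from rfl, hx, Pi.neg_apply]
  rw [Pi.add_apply, e, Real.norm_eq_abs]
  have h3 := Real.add_one_le_exp (u.1 x)
  have h4 := Real.add_one_le_exp (-(u.1 x))
  have h5 := Real.exp_pos (u.1 x)
  have h6 := Real.exp_pos (-(u.1 x))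
  rcases abs_cases (u.1 x) with h | h <;> linarith

/-- `B_p`: the subspace of `p`-centred elements of `M^{Φ₁}(p)`, with the Orlicz norm. -/
def B (p : PosDensity μ) : Submodule ℝ (orliczHeart p) where
  carrier := {u | ∫ x, u.1 x ∂p.measure = 0}
  add_mem' := by
    intro u v hu hv
    rw [mem_ofPred_eq] at *
    rw [integral_congr_ae (heart_coe_add p u v)]
    simp only [Pi.add_apply]
    rw [integral_add (integrable_heart p u) (integrable_heart p v), hu, hv, add_zero]
  zero_mem' := by
    rw [mem_ofPred_eq,
      integral_congr_ae (heart_coe_zero p)]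
    simp
  smul_mem' := by
    intro c u hu
    rw [mem_ofPred_eq] at *
    rw [integral_congr_ae (heart_coe_smul p c u)]
    simp only [Pi.smul_apply]
    rw [integral_smul, hu, smul_zero]

/-! ### The exponential charts -/

/-- The partition function `Z_p(u) = ∫ e^u p dμ`. -/
def Z (p : PosDensity μ) (u : orliczHeart p) : ℝ := ∫ x, Real.exp (u.1 x) ∂p.measure

theorem Z_pos (p : PosDensity μ) (u : orliczHeart p) : 0 < Z p u := by
  refine (integral_pos_iff_support_of_nonneg (fun x => (Real.exp_pos _).le)
    (integrable_exp p u)).2 ?_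
  have : Function.support (fun x => Real.exp (u.1 x)) = univ := by
    ext x; simp [Real.exp_ne_zero]
  rw [this, measure_univ]
  exact one_pos

theorem aestronglyMeasurable_expDensity (p : PosDensity μ) (u : orliczHeart p) :
    AEStronglyMeasurable (fun x => Real.exp (u.1 x) / Z p u * p.toFun x) μ :=
  (((Real.measurable_exp.comp_aemeasurable u.1.aemeasurable).div_const _).mul
    p.toFun.aemeasurable).aestronglyMeasurable

/-- The map `e_p(u) = (e^u / Z_p(u)) p`. -/
def expMap (p : PosDensity μ) (u : B p) : PosDensity μ where
  toFun := AEEqFun.mk _ (aestronglyMeasurable_expDensity p u.1)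
  pos := by
    filter_upwards [AEEqFun.coeFn_mk _ (aestronglyMeasurable_expDensity p u.1), p.pos] with x hx hp
    rw [hx]
    have := Z_pos p u.1
    positivity
  integral_eq_one := by
    rw [integral_congr_ae (AEEqFun.coeFn_mk _ (aestronglyMeasurable_expDensity p u.1))]
    have h1 : ∫ x, Real.exp (u.1.1 x) / Z p u.1 ∂p.measure = 1 := by
      rw [integral_div]
      exact div_self (Z_pos p u.1).ne'
    rw [← h1, PosDensity.measure, integral_withDensity_eq_integral_toReal_smul₀
      p.toFun.aemeasurable.ennreal_ofReal (Filter.Eventually.of_forall fun _ => ENNReal.ofReal_lt_top)]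
    refine integral_congr_ae ?_
    filter_upwards [p.pos] with x hx
    rw [ENNReal.toReal_ofReal hx.le, smul_eq_mul, mul_comm]

theorem aestronglyMeasurable_logMap (p q : PosDensity μ) :
    AEStronglyMeasurable (fun x => Real.log (q.toFun x / p.toFun x) -
      ∫ y, Real.log (q.toFun y / p.toFun y) ∂p.measure) μ :=
  ((Real.measurable_log.comp_aemeasurable
    (q.toFun.aemeasurable.div p.toFun.aemeasurable)).sub_const _).aestronglyMeasurable

open Classical in
/-- The map `q ↦ log (q / p) - ∫ log (q / p) p dμ`, extended by `0` to the densities `q` for which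
this random variable is not in `B_p`. -/
def logMap (p q : PosDensity μ) : B p :=
  if h : ∃ u : B p, u.1.1 = AEEqFun.mk _ (aestronglyMeasurable_logMap p q) then h.choose else 0

theorem logMap_expMap (p : PosDensity μ) (u : B p) : logMap p (expMap p u) = u := by
  have hμ : (fun x => Real.log ((expMap p u).toFun x / p.toFun x)) =ᵐ[μ]
      fun x => u.1.1 x - Real.log (Z p u.1) := by
    filter_upwards [AEEqFun.coeFn_mk _ (aestronglyMeasurable_expDensity p u.1), p.pos] with x hx hp
    rw [expMap, hx, mul_div_assoc, div_self hp.ne', mul_one,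
      Real.log_div (Real.exp_ne_zero _) (Z_pos p u.1).ne', Real.log_exp]
  have hint : ∫ y, Real.log ((expMap p u).toFun y / p.toFun y) ∂p.measure
      = -Real.log (Z p u.1) := by
    rw [integral_congr_ae (p.measure_ac.ae_le hμ),
      integral_sub (integrable_heart p u.1) (integrable_const _),
      show ∫ x, u.1.1 x ∂p.measure = 0 from u.2]
    simp
  have hu : u.1.1 = AEEqFun.mk _ (aestronglyMeasurable_logMap p (expMap p u)) := by
    refine AEEqFun.ext ?_
    filter_upwards [hμ, AEEqFun.coeFn_mk _ (aestronglyMeasurable_logMap p (expMap p u))]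
      with x h1 h2
    rw [h2, h1, hint]
    ring
  have hex : ∃ v : B p, v.1.1 = AEEqFun.mk _ (aestronglyMeasurable_logMap p (expMap p u)) :=
    ⟨u, hu⟩
  rw [logMap, dif_pos hex]
  exact Subtype.ext (Subtype.ext (hex.choose_spec.trans hu.symm))

/-- The chart `(𝓤_p, e_p⁻¹)`: its target is the open unit ball `𝓥_p` of `B_p`, its source is
`𝓤_p = e_p(𝓥_p)`, and its inverse is `e_p`. -/
def chart (p : PosDensity μ) : PartialEquiv (PosDensity μ) (B p) where
  toFun := logMap p
  invFun := expMap p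
  source := expMap p '' Metric.ball 0 1
  target := Metric.ball 0 1
  map_source' := by
    rintro _ ⟨u, hu, rfl⟩
    rwa [logMap_expMap]
  map_target' u hu := ⟨u, hu, rfl⟩
  left_inv' := by
    rintro _ ⟨u, _, rfl⟩
    rw [logMap_expMap]
  right_inv' u _ := logMap_expMap p u

/-! ### Atlases with values in Banach spaces -/

section Atlas

open scoped ContDiff Manifold

variable {X ι : Type*} {E : ι → Type*} [∀ i, NormedAddCommGroup (E i)] [∀ i, NormedSpace ℝ (E i)]

/-- A `C^∞` atlas on the set `X`: charts `φ i`, bijections of subsets of `X` onto open subsets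
of Banach spaces `E i` (which may vary with the chart), whose domains cover `X`, such that the image
of each overlap is open and the transition maps are of class `C^∞`. (Exchanging `i` and `j`, the
transition maps are `C^∞` isomorphisms.) -/
structure IsSmoothAtlas (φ : ∀ i, PartialEquiv X (E i)) : Prop where
  complete : ∀ i, CompleteSpace (E i)
  cover : ⋃ i, (φ i).source = univ
  isOpen_target : ∀ i, IsOpen (φ i).target
  isOpen_overlap : ∀ i j, IsOpen (φ i '' ((φ i).source ∩ (φ j).source))
  contDiffOn : ∀ i j, ContDiffOn ℝ ∞ (φ j ∘ (φ i).symm) (φ i '' ((φ i).source ∩ (φ j).source))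

/-- The topology defined by a family of charts: the finest one for which all the inverse charts
are continuous, i.e. `V` is open iff `φ i (V ∩ source)` is open in the target for every `i`. -/
abbrev atlasTopology (φ : ∀ i, PartialEquiv X (E i)) : TopologicalSpace X :=
  ⨆ i, TopologicalSpace.coinduced (fun v : (φ i).target => (φ i).symm v) inferInstance

/-- The charts `φ i` that meet the subspace `C` of `X` have their domain in `C` and make `C` a
`C^∞` manifold modelled on the single Banach space `F`, after composition of each `φ i` with a
toplinear isomorphism of its Banach space `E i` onto `F`. -/
def IsModelledOn [TopologicalSpace X] (φ : ∀ i, PartialEquiv X (E i))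
    (C : Set X) (F : Type*) [NormedAddCommGroup F] [NormedSpace ℝ F] : Prop :=
  ∃ _ : ChartedSpace F C, IsManifold 𝓘(ℝ, F) ∞ C ∧
    (∀ i, ((φ i).source ∩ C).Nonempty → (φ i).source ⊆ C ∧
      ∃ L : E i ≃L[ℝ] F, ∃ e ∈ atlas F C, e.source = Subtype.val ⁻¹' (φ i).source ∧
        ∀ x ∈ e.source, e x = L (φ i x)) ∧
    (∀ e ∈ atlas F C, ∃ i, ∃ L : E i ≃L[ℝ] F, e.source = Subtype.val ⁻¹' (φ i).source ∧
        ∀ x ∈ e.source, e x = L (φ i x))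

end Atlas

/-- The set of positive densities with the topology defined by the exponential charts. -/
instance : TopologicalSpace (PosDensity μ) := atlasTopology (chart (μ := μ))

/-- `μ` is diffuse on the set `D`: no measurable subset of `D` is an atom. -/
def IsDiffuseOn (μ : Measure Ω) (D : Set Ω) : Prop :=
  ∀ A ⊆ D, MeasurableSet A → 0 < μ A → ∃ A' ⊆ A, MeasurableSet A' ∧ 0 < μ A' ∧ 0 < μ (A \ A')

end InfoGeom

end

/-!
The transition maps are affine. If `e_p(u₀) = e_q(v₀)`, then `e_p(u) = e_q(T u)` for *every* `u`
in `B_p`, where `T u` is `u - u₀ + v₀` minus its `q`-mean; for this `T` to be a continuous map of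
`B_p` to `B_q` it is enough that `M^{Φ₁}(p)` embeds continuously in `M^{Φ₁}(q)`
(`exists_contDiff_transition`). That holds whenever `q = e_p(u)`, because `e^u Φ₁(f) ≤ e^{2u} +
Φ₁(2f)` and all the exponential moments of `u` are finite (`exists_clm_expMap`). The overlap of
two charts is then the part of one unit ball that `T` maps into the other one, which is open.
Continuity of linear maps is always derived from an estimate of the modular `∫ Φ₁(f) p dμ`
(`exists_clm_of_orliczModular_le`), since the unit ball of the Orlicz norm lies in that of the
modular (`orliczModular_le_one`) and the norm is at most the modular plus one. Completeness of
`M^{Φ₁}(p)` follows by summing absolutely convergent series almost everywhere.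

The relation `q ∈ e_p(B_p)` is an equivalence relation with open classes, so connected components
lie in classes, and within a class all the `B_q` are isomorphic. Chart domains are connected and
open, so those that meet a component lie in it; the rest of the second part holds for any smooth
atlas (`IsSmoothAtlas.isModelledOn`).

For the third part it is enough that `M^{Φ₁}(p) ≅ M^{Φ₁}(q) × M^{Φ₁}(p)` for all `p` and `q`: by
symmetry `M^{Φ₁}(p) ≅ M^{Φ₁}(q)`, that is `ℝ × B_p ≅ ℝ × B_q`, and the line can be cancelled since
any two closed hyperplanes of a Banach space are isomorphic (`nonempty_equiv_of_real_prod_equiv`).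
By separability there is a real random variable `F` that generates the `σ`-algebra up to null
sets, so that `M^{Φ₁}(q)` is the space `M^{Φ₁}(ρ)` of the distribution `ρ` of `F` under `q`. Let
`γ ρ` (`geomProd`) be the measure `∑ₖ 2⁻ᵏ⁻¹ δₖ ⊗ ρ` on `ℕ × ℝ`. Shifting the first coordinate
shows that `M^{Φ₁}(γ ρ) ≅ M^{Φ₁}(ρ) × M^{Φ₁}(γ ρ)` (`nonempty_heart_geomProd_equiv`). On the
diffuse set `F` has no point masses under `p`, so its distribution function is uniformly
distributed and some random variable `W` on this set has the distribution `γ ρ`, up to a factor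
(`exists_map_restrict_eq_smul`). Composition with `W` embeds `M^{Φ₁}(γ ρ)` in `M^{Φ₁}(p)`, with
the conditional expectation as a bounded left inverse by Jensen's inequality, so `M^{Φ₁}(γ ρ)` is
a direct factor of `M^{Φ₁}(p)` and lends it the absorption of `M^{Φ₁}(ρ) ≅ M^{Φ₁}(q)`.
-/

namespace InfoGeom

section Orlicz

variable {Ω Ω' : Type*} [MeasurableSpace Ω] [MeasurableSpace Ω'] {μ : Measure Ω} {μ' : Measure Ω'}

/-! ### The modular `∫ Φ₁(f) dν` and the Orlicz norm -/

/-- The modular `∫ Φ₁(f) dν` with values in `[0, ∞]`. -/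
noncomputable def orliczModular (ν : Measure Ω) (f : Ω → ℝ) : ℝ≥0∞ :=
  ∫⁻ x, ENNReal.ofReal (Φ₁ (f x)) ∂ν

theorem orliczModular_congr {ν : Measure Ω} {f g : Ω → ℝ} (h : f =ᵐ[ν] g) :
    orliczModular ν f = orliczModular ν g := by
  refine lintegral_congr_ae ?_
  filter_upwards [h] with x hx
  rw [hx]

theorem orliczModular_mono {ν : Measure Ω} {f g : Ω → ℝ} (h : ∀ᵐ x ∂ν, |f x| ≤ |g x|) :
    orliczModular ν f ≤ orliczModular ν g :=
  lintegral_mono_ae (h.mono fun _ hx => ENNReal.ofReal_le_ofReal (Φ₁_le_Φ₁ hx))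

theorem Φ₁_zero : Φ₁ 0 = 0 := by simp [Φ₁]

theorem Φ₁_add_le (a b : ℝ) : Φ₁ (a + b) ≤ Φ₁ (2 * a) + Φ₁ (2 * b) := by
  rcases le_total |a| |b| with h | h
  · have : Φ₁ (a + b) ≤ Φ₁ (2 * b) := by
      refine Φ₁_le_Φ₁ ?_
      rw [abs_mul, abs_two]
      linarith [abs_add_le a b]
    linarith [Φ₁_nonneg (2 * a)]
  · have : Φ₁ (a + b) ≤ Φ₁ (2 * a) := by
      refine Φ₁_le_Φ₁ ?_
      rw [abs_mul, abs_two]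
      linarith [abs_add_le a b]
    linarith [Φ₁_nonneg (2 * b)]

theorem measurable_ofReal_Φ₁ {ν : Measure Ω} {f : Ω → ℝ} (hf : AEMeasurable f ν) :
    AEMeasurable (fun x => ENNReal.ofReal (Φ₁ (f x))) ν :=
  (continuous_Φ₁.measurable.comp_aemeasurable hf).ennreal_ofReal

theorem orliczModular_add_le {ν : Measure Ω} {f g : Ω → ℝ} (hf : AEMeasurable f ν) :
    orliczModular ν (f + g) ≤
      orliczModular ν ((2 : ℝ) • f) + orliczModular ν ((2 : ℝ) • g) := by
  unfold orliczModular
  rw [← lintegral_add_left' (measurable_ofReal_Φ₁ (hf.const_smul (2 : ℝ)))]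
  refine lintegral_mono fun x => ?_
  rw [← ENNReal.ofReal_add (Φ₁_nonneg _) (Φ₁_nonneg _)]
  exact ENNReal.ofReal_le_ofReal (Φ₁_add_le _ _)

theorem orliczENorm_le_orliczModular_add_one {ν : Measure Ω} {f : Ω → ℝ} (hf : AEMeasurable f ν) :
    orliczENorm ν f ≤ orliczModular ν f + 1 := by
  refine iSup₂_le fun g hg => ?_
  calc ∫⁻ x, ENNReal.ofReal |f x * g x| ∂ν
      ≤ ∫⁻ x, (ENNReal.ofReal (Φ₁ (f x)) + ENNReal.ofReal (Ψ₁ (g x))) ∂ν :=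
        lintegral_mono fun x =>
          (ENNReal.ofReal_le_ofReal (young _ _)).trans ENNReal.ofReal_add_le
    _ = ∫⁻ x, ENNReal.ofReal (Φ₁ (f x)) ∂ν + ∫⁻ x, ENNReal.ofReal (Ψ₁ (g x)) ∂ν :=
        lintegral_add_left' (measurable_ofReal_Φ₁ hf) _
    _ ≤ _ := by gcongr; exacts [le_rfl, hg.2]

/-- The case of equality in Young's inequality. -/
theorem young_eq (b : ℝ) : |b * Real.sinh b| = Φ₁ b + Ψ₁ (Real.sinh b) := by
  have h : |Real.sinh b| = Real.sinh |b| := Real.abs_sinh b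
  rw [abs_mul, Ψ₁_eq, h, Real.arsinh_sinh, add_comm 1, ← Real.cosh_sq, Real.sqrt_sq
    (Real.cosh_pos _).le, Φ₁, Real.cosh_abs]
  ring

theorem Ψ₁_nonneg (y : ℝ) : 0 ≤ Ψ₁ y := by
  simpa [Φ₁_zero] using young 0 y

theorem Ψ₁_mul_le {t : ℝ} (h0 : 0 ≤ t) (h1 : t ≤ 1) (y : ℝ) : Ψ₁ (t * y) ≤ t * Ψ₁ y := by
  have e := young_eq (Real.arsinh (t * y))
  rw [Real.sinh_arsinh] at e
  have h2 := young (Real.arsinh (t * y)) y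
  have h3 : |Real.arsinh (t * y) * (t * y)| = t * |Real.arsinh (t * y) * y| := by
    rw [mul_left_comm, abs_mul, abs_of_nonneg h0]
  have h4 := Φ₁_nonneg (Real.arsinh (t * y))
  nlinarith [mul_le_mul_of_nonneg_left h2 h0, mul_nonneg (sub_nonneg.2 h1) h4]

/-- The function obtained from a function of Orlicz norm at most one by replacing the values of
absolute value greater than `n` by zero has modular at most one. The test function is `sinh` of
the truncation, for which Young's inequality is an equality. -/
theorem orliczModular_truncation_le_one {ν : Measure Ω} [IsFiniteMeasure ν] {h : Ω → ℝ}
    (hm : Measurable h) (hle : orliczENorm ν h ≤ 1) (n : ℕ) :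
    orliczModular ν (fun x => if |h x| ≤ n then h x else 0) ≤ 1 := by
  set b : Ω → ℝ := fun x => if |h x| ≤ n then h x else 0 with hb
  have hbm : Measurable b := Measurable.ite (measurableSet_le hm.abs measurable_const) hm
    measurable_const
  have hbn : ∀ x, |b x| ≤ n := by
    intro x
    simp only [hb]
    split_ifs with h
    · exact h
    · simp
  set g : Ω → ℝ := fun x => Real.sinh (b x) with hg
  have hgm : Measurable g := Real.measurable_sinh.comp hbm
  set A : ℝ≥0∞ := ∫⁻ x, ENNReal.ofReal (Ψ₁ (g x)) ∂ν with hA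
  have hsum : ∫⁻ x, ENNReal.ofReal |h x * g x| ∂ν = orliczModular ν b + A := by
    rw [orliczModular, hA, ← lintegral_add_left' (measurable_ofReal_Φ₁ hbm.aemeasurable)]
    refine lintegral_congr fun x => ?_
    rw [← ENNReal.ofReal_add (Φ₁_nonneg _) (Ψ₁_nonneg _), ← young_eq]
    simp only [hg, hb]
    split_ifs with h <;> simp
  have hAtop : A ≠ ⊤ := by
    have : ∀ x, Ψ₁ (g x) ≤ n * Real.sinh n := by
      intro x
      have h1 := young_eq (b x)
      have h2 := Φ₁_nonneg (b x)
      have h3 : |b x * Real.sinh (b x)| ≤ n * Real.sinh n := by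
        rw [abs_mul, Real.abs_sinh]
        have h4 := Real.sinh_le_sinh.2 (hbn x)
        have := Real.sinh_nonneg_iff.2 (abs_nonneg (b x))
        gcongr
        exact hbn x
      simp only [hg]
      linarith
    refine ne_top_of_le_ne_top ?_ (lintegral_mono fun x => ENNReal.ofReal_le_ofReal (this x))
    rw [lintegral_const]
    exact ENNReal.mul_ne_top ENNReal.ofReal_ne_top (measure_ne_top _ _)
  rcases le_or_gt A 1 with h1 | h1
  · have : ∫⁻ x, ENNReal.ofReal |h x * g x| ∂ν ≤ 1 :=
      (le_iSup₂_of_le (f := fun (g : Ω → ℝ) (_ : Measurable g ∧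
        ∫⁻ x, ENNReal.ofReal (Ψ₁ (g x)) ∂ν ≤ 1) => ∫⁻ x, ENNReal.ofReal |h x * g x| ∂ν)
        g ⟨hgm, h1⟩ le_rfl).trans hle
    exact (le_self_add.trans hsum.ge).trans this
  · -- If `A > 1`, test with `g / A`: then `modular + A ≤ A`.
    have hA1 : 1 < A.toReal := by
      rw [← ENNReal.toReal_one]
      exact (ENNReal.toReal_lt_toReal ENNReal.one_ne_top hAtop).2 h1
    have hA0 : 0 < A.toReal := by linarith
    have hAi : ENNReal.ofReal A.toReal⁻¹ * A = 1 := by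
      rw [ENNReal.ofReal_inv_of_pos hA0, ENNReal.ofReal_toReal hAtop]
      exact ENNReal.inv_mul_cancel (by rintro h; simp [h] at h1) hAtop
    have ht : ∫⁻ x, ENNReal.ofReal (Ψ₁ (A.toReal⁻¹ * g x)) ∂ν ≤ 1 := by
      rw [← hAi, hA, ← lintegral_const_mul' _ _ ENNReal.ofReal_ne_top]
      refine lintegral_mono fun x => ?_
      rw [← ENNReal.ofReal_mul (by positivity)]
      exact ENNReal.ofReal_le_ofReal
        (Ψ₁_mul_le (by positivity) (inv_le_one_of_one_le₀ hA1.le) _)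
    have h2 : ∫⁻ x, ENNReal.ofReal |h x * (A.toReal⁻¹ * g x)| ∂ν ≤ 1 :=
      (le_iSup₂_of_le (f := fun (g : Ω → ℝ) (_ : Measurable g ∧
        ∫⁻ x, ENNReal.ofReal (Ψ₁ (g x)) ∂ν ≤ 1) => ∫⁻ x, ENNReal.ofReal |h x * g x| ∂ν)
        _ ⟨hgm.const_mul _, ht⟩ le_rfl).trans hle
    have h3 : ∫⁻ x, ENNReal.ofReal |h x * (A.toReal⁻¹ * g x)| ∂ν
        = ENNReal.ofReal A.toReal⁻¹ * (orliczModular ν b + A) := by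
      rw [← hsum, ← lintegral_const_mul' _ _ ENNReal.ofReal_ne_top]
      refine lintegral_congr fun x => ?_
      rw [mul_left_comm, abs_mul, abs_of_pos (by positivity : 0 < A.toReal⁻¹),
        ENNReal.ofReal_mul (by positivity)]
    rw [h3, mul_add, hAi] at h2
    have h4 : ENNReal.ofReal A.toReal⁻¹ * orliczModular ν b ≤ 0 :=
      (ENNReal.add_le_add_iff_right ENNReal.one_ne_top).1 (by simpa using h2)
    have h5 := nonpos_iff_eq_zero.1 h4
    rcases mul_eq_zero.1 h5 with h6 | h6
    · have := inv_pos.2 hA0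
      rw [ENNReal.ofReal_eq_zero] at h6
      linarith
    · rw [h6]; exact zero_le_one

/-- The Luxemburg norm is dominated by the Orlicz norm. -/
theorem orliczModular_le_one {ν : Measure Ω} [IsFiniteMeasure ν] {h : Ω → ℝ}
    (hm : AEMeasurable h ν) (hle : orliczENorm ν h ≤ 1) : orliczModular ν h ≤ 1 := by
  wlog hmeas : Measurable h generalizing h
  · rw [orliczModular_congr hm.ae_eq_mk]
    rw [orliczENorm_congr hm.ae_eq_mk] at hle
    exact this hm.measurable_mk.aemeasurable hle hm.measurable_mk
  have key : orliczModular ν h =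
      ⨆ n : ℕ, orliczModular ν (fun x => if |h x| ≤ n then h x else 0) := by
    unfold orliczModular
    rw [← lintegral_iSup]
    · refine lintegral_congr fun x => le_antisymm ?_ (iSup_le fun n => ?_)
      · obtain ⟨n, hn⟩ := exists_nat_ge |h x|
        refine le_iSup_of_le n ?_
        simp only [if_pos hn, le_refl]
      · dsimp only
        split_ifs
        · exact le_rfl
        · simp [Φ₁_zero]
    · intro n
      exact (continuous_Φ₁.measurable.comp (Measurable.ite
        (measurableSet_le hmeas.abs measurable_const) hmeas measurable_const)).ennreal_ofReal
    · intro n m hnm x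
      refine ENNReal.ofReal_le_ofReal (Φ₁_le_Φ₁ ?_)
      have : (n : ℝ) ≤ m := by exact_mod_cast hnm
      dsimp only
      split_ifs with h1 h2
      · exact le_rfl
      · exact absurd (h1.trans this) h2
      · simp
      · simp
  rw [key]
  exact iSup_le fun n => orliczModular_truncation_le_one hmeas hle n

/-- On a probability space the Orlicz norm dominates a multiple of the `L¹`-norm. -/
theorem exists_lintegral_le_orliczENorm (ν : Measure Ω) [IsProbabilityMeasure ν] :
    ∃ C : ℝ, 0 < C ∧ ∀ f : Ω → ℝ,
      ∫⁻ x, ENNReal.ofReal |f x| ∂ν ≤ ENNReal.ofReal C * orliczENorm ν f := by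
  obtain ⟨c, hc, hc1⟩ : ∃ c : ℝ, 0 < c ∧ Ψ₁ c ≤ 1 := by
    have h0 : Ψ₁ 0 = 0 := by simp [Ψ₁]
    have : ∀ᶠ c in nhds (0 : ℝ), Ψ₁ c < 1 :=
      continuous_Ψ₁.continuousAt.eventually (gt_mem_nhds (by rw [h0]; norm_num))
    obtain ⟨ε, hε, hb⟩ := Metric.eventually_nhds_iff.1 this
    refine ⟨ε / 2, by positivity, (hb ?_).le⟩
    rw [Real.dist_eq, sub_zero, abs_of_pos (by positivity)]
    linarith
  refine ⟨c⁻¹, by positivity, fun f => ?_⟩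
  have h1 : ∫⁻ x, ENNReal.ofReal |f x * c| ∂ν ≤ orliczENorm ν f := by
    refine le_iSup₂_of_le (fun _ => c) ⟨measurable_const, ?_⟩ le_rfl
    rw [lintegral_const, measure_univ, mul_one]
    exact ENNReal.ofReal_le_one.2 hc1
  calc ∫⁻ x, ENNReal.ofReal |f x| ∂ν
      = ∫⁻ x, ENNReal.ofReal c⁻¹ * ENNReal.ofReal |f x * c| ∂ν := by
        refine lintegral_congr fun x => ?_
        rw [← ENNReal.ofReal_mul (by positivity), abs_mul, abs_of_pos hc]
        congr 1
        field_simp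
    _ = ENNReal.ofReal c⁻¹ * ∫⁻ x, ENNReal.ofReal |f x * c| ∂ν :=
        lintegral_const_mul' _ _ ENNReal.ofReal_ne_top
    _ ≤ _ := by gcongr

/-! ### The spaces `M^{Φ₁}(p)` -/

theorem PosDensity.ae_measure (p : PosDensity μ) : ae p.measure = ae μ :=
  le_antisymm p.measure_ac.ae_le p.ac_measure.ae_le

theorem mem_orliczHeart_iff {p : PosDensity μ} {f : Ω →ₘ[μ] ℝ} :
    f ∈ orliczHeart p ↔ ∀ k : ℝ, 0 < k → orliczModular p.measure (k • (f : Ω → ℝ)) < ⊤ := Iff.rfl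

theorem orliczModular_smul_lt_top (p : PosDensity μ) (f : orliczHeart p) (k : ℝ) :
    orliczModular p.measure (k • (f.1 : Ω → ℝ)) < ⊤ := by
  refine (orliczModular_mono (g := (|k| + 1) • (f.1 : Ω → ℝ)) (ae_of_all _ fun x => ?_)).trans_lt
    (mem_orliczHeart_iff.1 f.2 (|k| + 1) (by positivity))
  simp only [Pi.smul_apply, smul_eq_mul, abs_mul]
  rw [abs_of_pos (by positivity : 0 < |k| + 1)]
  exact mul_le_mul_of_nonneg_right (by linarith) (abs_nonneg _)

theorem orliczModular_lt_top (p : PosDensity μ) (f : orliczHeart p) :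
    orliczModular p.measure f.1 < ⊤ := by
  simpa using orliczModular_smul_lt_top p f 1

theorem orliczModular_smul_le_one (p : PosDensity μ) (f : orliczHeart p) {k : ℝ}
    (h : |k| * ‖f‖ ≤ 1) : orliczModular p.measure (k • (f.1 : Ω → ℝ)) ≤ 1 := by
  refine orliczModular_le_one ((p.aemeasurable f.1).const_smul k) ?_
  rw [orliczENorm_smul, ← ENNReal.ofReal_toReal (orliczENorm_heart_lt_top p f).ne,
    ← orliczHeart_norm_def, ← ENNReal.ofReal_mul (abs_nonneg _)]
  exact ENNReal.ofReal_le_one.2 h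

theorem ofReal_norm_eq (p : PosDensity μ) (f : orliczHeart p) :
    ENNReal.ofReal ‖f‖ = orliczENorm p.measure f.1 := by
  rw [orliczHeart_norm_def, ENNReal.ofReal_toReal (orliczENorm_heart_lt_top p f).ne]

theorem orliczHeart_coe_sub (p : PosDensity μ) (f g : orliczHeart p) :
    (f - g).1 =ᵐ[μ] (f.1 : Ω → ℝ) - g.1 := AEEqFun.coeFn_sub f.1 g.1

theorem orliczHeart_ext {p : PosDensity μ} {f g : orliczHeart p}
    (h : (f.1 : Ω → ℝ) =ᵐ[μ] g.1) : f = g := Subtype.ext (AEEqFun.ext h)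

theorem orliczHeart_coe_sum (p : PosDensity μ) (u : ℕ → orliczHeart p) (n : ℕ) :
    (∑ i ∈ Finset.range n, u i).1 =ᵐ[μ] fun x => ∑ i ∈ Finset.range n, (u i).1 x := by
  induction n with
  | zero =>
    simp only [Finset.range_zero, Finset.sum_empty]
    exact AEEqFun.coeFn_zero (β := ℝ) (μ := μ)
  | succ n ih =>
    rw [Finset.sum_range_succ]
    filter_upwards [ih, AEEqFun.coeFn_add (∑ i ∈ Finset.range n, u i).1 (u n).1] with x h1 h2
    rw [Finset.sum_range_succ, ← h1]
    exact h2

/-- An absolutely convergent series in `M^{Φ₁}(p)` converges absolutely almost everywhere. -/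
theorem ae_summable_of_summable_norm (p : PosDensity μ) {u : ℕ → orliczHeart p}
    (hu : Summable fun n => ‖u n‖) : ∀ᵐ x ∂μ, Summable fun n => (u n).1 x := by
  obtain ⟨C, -, hC⟩ := exists_lintegral_le_orliczENorm p.measure
  rw [← p.ae_measure]
  have hm : ∀ n, AEMeasurable (fun x => ENNReal.ofReal |(u n).1 x|) p.measure := fun n =>
    (p.aemeasurable (u n).1).norm.ennreal_ofReal
  have h1 : ∫⁻ x, ∑' n, ENNReal.ofReal |(u n).1 x| ∂p.measure ≠ ⊤ := by
    rw [lintegral_tsum hm]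
    refine ne_top_of_le_ne_top ?_ (ENNReal.tsum_le_tsum fun n => hC (u n).1)
    rw [ENNReal.tsum_mul_left]
    refine ENNReal.mul_ne_top ENNReal.ofReal_ne_top ?_
    simp_rw [← ofReal_norm_eq]
    exact hu.tsum_ofReal_ne_top
  filter_upwards [ae_lt_top' (AEMeasurable.tsum hm) h1] with x hx
  refine Summable.of_abs ?_
  simpa using ENNReal.summable_toReal hx.ne

theorem ofReal_abs_tsum_sub_sum_mul_le {a : ℕ → ℝ} (ha : Summable a) (N : ℕ) (c : ℝ) :
    ENNReal.ofReal |(∑' n, a n - ∑ i ∈ Finset.range N, a i) * c| ≤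
      ∑' n, ENNReal.ofReal |a (n + N) * c| := by
  have h2 : Summable fun n => |a (n + N) * c| :=
    (((summable_nat_add_iff N).2 ha).mul_right c).abs
  have h3 : ∑' n, a n - ∑ i ∈ Finset.range N, a i = ∑' n, a (n + N) := by
    rw [← ha.sum_add_tsum_nat_add N, add_sub_cancel_left]
  have h4 : ‖∑' n, a (n + N) * c‖ ≤ ∑' n, ‖a (n + N) * c‖ := norm_tsum_le_tsum_norm h2
  rw [tsum_mul_right] at h4
  rw [← ENNReal.ofReal_tsum_of_nonneg (fun _ => abs_nonneg _) h2, h3]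
  exact ENNReal.ofReal_le_ofReal h4

/-- The norm of the remainder of a series is at most the sum of the norms. -/
theorem orliczENorm_tsum_sub_sum_le (p : PosDensity μ) {u : ℕ → orliczHeart p}
    (hu : Summable fun n => ‖u n‖) (N : ℕ) :
    orliczENorm p.measure ((fun x => ∑' n, (u n).1 x) - (∑ i ∈ Finset.range N, u i).1) ≤
      ENNReal.ofReal (∑' n, ‖u (n + N)‖) := by
  rw [ENNReal.ofReal_tsum_of_nonneg (fun _ => norm_nonneg _) ((summable_nat_add_iff N).2 hu)]
  refine iSup₂_le fun g hg => ?_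
  have hm : ∀ n, AEMeasurable (fun x => ENNReal.ofReal |(u (n + N)).1 x * g x|) p.measure :=
    fun n => ((p.aemeasurable (u (n + N)).1).mul hg.1.aemeasurable).norm.ennreal_ofReal
  refine le_trans (lintegral_mono_ae
    (g := fun x => ∑' n, ENNReal.ofReal |(u (n + N)).1 x * g x|) ?_) ?_
  · rw [p.ae_measure]
    filter_upwards [ae_summable_of_summable_norm p hu, orliczHeart_coe_sum p u N] with x hx h1
    rw [Pi.sub_apply, h1]
    exact ofReal_abs_tsum_sub_sum_mul_le hx N (g x)
  · rw [lintegral_tsum hm]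
    refine ENNReal.tsum_le_tsum fun n => ?_
    rw [ofReal_norm_eq]
    exact le_iSup₂_of_le g hg le_rfl

theorem aemeasurable_tsum_orliczHeart (p : PosDensity μ) {u : ℕ → orliczHeart p}
    (hu : Summable fun n => ‖u n‖) : AEMeasurable (fun x => ∑' n, (u n).1 x) μ := by
  refine aemeasurable_of_tendsto_metrizable_ae Filter.atTop
    (f := fun n x => ∑ i ∈ Finset.range n, (u i).1 x) (fun n => ?_) ?_
  · exact (AEMeasurable.congr (AEEqFun.aemeasurable _) (orliczHeart_coe_sum p u n))
  · filter_upwards [ae_summable_of_summable_norm p hu] with x hx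
    exact hx.hasSum.tendsto_sum_nat

/-- The sum of an absolutely convergent series lies in `M^{Φ₁}(p)`: for each `k` it differs from a
partial sum by a function of Orlicz norm at most `1 / (2 k)`. -/
theorem mk_tsum_mem_orliczHeart (p : PosDensity μ) {u : ℕ → orliczHeart p}
    (hu : Summable fun n => ‖u n‖) :
    AEEqFun.mk _ (aemeasurable_tsum_orliczHeart p hu).aestronglyMeasurable ∈ orliczHeart p := by
  have hfm := aemeasurable_tsum_orliczHeart p hu
  have hrem := orliczENorm_tsum_sub_sum_le p hu
  set f : Ω → ℝ := fun x => ∑' n, (u n).1 x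
  rw [mem_orliczHeart_iff]
  intro k hk
  obtain ⟨N, hN⟩ : ∃ N, ∑' n, ‖u (n + N)‖ < (2 * k)⁻¹ :=
    (((tendsto_sum_nat_add fun n => ‖u n‖).eventually
      (gt_mem_nhds (by positivity : (0 : ℝ) < (2 * k)⁻¹))).exists)
  have hN' := hrem N
  set s : orliczHeart p := ∑ i ∈ Finset.range N, u i
  have e : k • (AEEqFun.mk f hfm.aestronglyMeasurable : Ω → ℝ) =ᵐ[p.measure]
      k • (s.1 : Ω → ℝ) + k • (f - s.1) := by
    rw [p.ae_measure]
    filter_upwards [AEEqFun.coeFn_mk f hfm.aestronglyMeasurable] with x hx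
    simp only [Pi.smul_apply, Pi.add_apply, Pi.sub_apply, smul_eq_mul, hx]
    ring
  rw [orliczModular_congr e]
  refine (orliczModular_add_le ((p.aemeasurable s.1).const_smul k)).trans_lt
    (ENNReal.add_lt_top.2 ⟨?_, ?_⟩)
  · rw [smul_smul]
    exact orliczModular_smul_lt_top p s _
  · refine lt_of_le_of_lt (orliczModular_le_one
      ((((hfm.mono_ac p.measure_ac).sub (p.aemeasurable s.1)).const_smul k).const_smul (2 : ℝ)) ?_)
      ENNReal.one_lt_top
    rw [smul_smul, orliczENorm_smul]
    refine (mul_le_mul_right hN' _).trans ?_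
    rw [← ENNReal.ofReal_mul (abs_nonneg _), abs_of_pos (by positivity)]
    refine ENNReal.ofReal_le_one.2 ?_
    rw [← mul_inv_cancel₀ (by positivity : (2 * k) ≠ 0)]
    gcongr

instance (p : PosDensity μ) : CompleteSpace (orliczHeart p) := by
  refine NormedAddCommGroup.completeSpace_of_summable_imp_tendsto fun u hu => ?_
  have hmem := mk_tsum_mem_orliczHeart p hu
  refine ⟨⟨_, hmem⟩, ?_⟩
  rw [tendsto_iff_norm_sub_tendsto_zero]
  refine squeeze_zero (fun _ => norm_nonneg _) (fun N => ?_) (tendsto_sum_nat_add fun n => ‖u n‖)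
  rw [norm_sub_rev, orliczHeart_norm_def]
  refine ENNReal.toReal_le_of_le_ofReal (tsum_nonneg fun _ => norm_nonneg _) ?_
  refine le_trans (le_of_eq (orliczENorm_congr ?_)) (orliczENorm_tsum_sub_sum_le p hu N)
  rw [p.ae_measure]
  filter_upwards [AEEqFun.coeFn_mk _ (aemeasurable_tsum_orliczHeart p hu).aestronglyMeasurable,
    orliczHeart_coe_sub p ⟨_, hmem⟩ (∑ i ∈ Finset.range N, u i)] with x h1 h2
  rw [h2, Pi.sub_apply, Pi.sub_apply, h1]

/-- A linear map between the spaces `M^{Φ₁}` that is bounded in the modular sense is well defined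
and continuous. -/
theorem exists_clm_of_orliczModular_le (p : PosDensity μ) (p' : PosDensity μ')
    (T : orliczHeart p → Ω' → ℝ) (hmeas : ∀ f, AEMeasurable (T f) μ')
    (hadd : ∀ f g, T (f + g) =ᵐ[μ'] T f + T g) (hsmul : ∀ (k : ℝ) f, T (k • f) =ᵐ[μ'] k • T f)
    (c : ℝ) (hc : 0 < c) (C : ℝ≥0∞) (hC : C ≠ ⊤)
    (hmod : ∀ f, orliczModular p'.measure (T f) ≤
      C * (1 + orliczModular p.measure (c • (f.1 : Ω → ℝ)))) :
    ∃ L : orliczHeart p →L[ℝ] orliczHeart p', ∀ f, (L f).1 =ᵐ[μ'] T f := by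
  have hfin : ∀ f, orliczModular p'.measure (T f) < ⊤ := fun f =>
    (hmod f).trans_lt (ENNReal.mul_lt_top hC.lt_top
      (ENNReal.add_lt_top.2 ⟨ENNReal.one_lt_top, orliczModular_smul_lt_top p f c⟩))
  have hmem : ∀ f, AEEqFun.mk (T f) (hmeas f).aestronglyMeasurable ∈ orliczHeart p' := by
    intro f
    rw [mem_orliczHeart_iff]
    intro k _
    refine lt_of_le_of_lt (le_of_eq (orliczModular_congr ?_)) (hfin (k • f))
    rw [p'.ae_measure]
    filter_upwards [AEEqFun.coeFn_mk (T f) (hmeas f).aestronglyMeasurable, hsmul k f] with x h1 h2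
    rw [h2, Pi.smul_apply, Pi.smul_apply, h1]
  have hcoe : ∀ f, AEEqFun.mk (T f) (hmeas f).aestronglyMeasurable =ᵐ[μ'] T f :=
    fun f => AEEqFun.coeFn_mk _ _
  let L₀ : orliczHeart p →ₗ[ℝ] orliczHeart p' :=
    { toFun := fun f => ⟨_, hmem f⟩
      map_add' := by
        intro f g
        refine orliczHeart_ext ?_
        refine ((hcoe (f + g)).trans (hadd f g)).trans ?_
        refine (((hcoe f).add (hcoe g)).symm).trans ?_
        exact (AEEqFun.coeFn_add _ _).symm
      map_smul' := by
        intro k f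
        refine orliczHeart_ext ?_
        refine ((hcoe (k • f)).trans (hsmul k f)).trans ?_
        refine (((hcoe f).const_smul k).symm).trans ?_
        exact (AEEqFun.coeFn_smul _ _).symm }
  have hnorm : ∀ f, c * ‖f‖ ≤ 1 → ‖L₀ f‖ ≤ (C * 2 + 1).toReal := by
    intro f hf
    rw [orliczHeart_norm_def]
    refine ENNReal.toReal_mono (ENNReal.add_ne_top.2
      ⟨ENNReal.mul_ne_top hC ENNReal.ofNat_ne_top, ENNReal.one_ne_top⟩) ?_
    refine (orliczENorm_le_orliczModular_add_one (p'.aemeasurable _)).trans ?_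
    gcongr
    rw [orliczModular_congr (g := T f) (by rw [p'.ae_measure]; exact hcoe f)]
    refine (hmod f).trans ?_
    gcongr
    rw [← one_add_one_eq_two]
    gcongr
    exact orliczModular_smul_le_one p f (by rwa [abs_of_pos hc])
  refine ⟨L₀.mkContinuous (c * (C * 2 + 1).toReal) fun f => ?_, fun f => hcoe f⟩
  rcases eq_or_ne f 0 with rfl | hf
  · simp
  have hf0 : 0 < ‖f‖ := norm_pos_iff.2 hf
  have h1 := hnorm ((c * ‖f‖)⁻¹ • f) (by
    rw [norm_smul, Real.norm_eq_abs, abs_of_pos (by positivity)]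
    exact le_of_eq (by field_simp))
  rw [map_smul, norm_smul, Real.norm_eq_abs, abs_of_pos (by positivity),
    inv_mul_le_iff₀ (by positivity)] at h1
  linarith

/-- The mean value `u ↦ ∫ u q dμ` as a continuous functional. -/
theorem exists_clm_integral (q : PosDensity μ) :
    ∃ L : orliczHeart q →L[ℝ] ℝ, ∀ f, L f = ∫ x, f.1 x ∂q.measure := by
  obtain ⟨C, hC0, hC⟩ := exists_lintegral_le_orliczENorm q.measure
  let L₀ : orliczHeart q →ₗ[ℝ] ℝ :=
    { toFun := fun f => ∫ x, f.1 x ∂q.measure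
      map_add' := by
        intro f g
        rw [integral_congr_ae (heart_coe_add q f g)]
        exact integral_add (integrable_heart q f) (integrable_heart q g)
      map_smul' := by
        intro k f
        rw [integral_congr_ae (heart_coe_smul q k f)]
        simp only [Pi.smul_apply, RingHom.id_apply]
        exact integral_smul k _ }
  refine ⟨L₀.mkContinuous C fun f => ?_, fun f => rfl⟩
  refine (norm_integral_le_lintegral_norm _).trans ?_
  refine ENNReal.toReal_le_of_le_ofReal (by positivity) ?_
  rw [ENNReal.ofReal_mul hC0.le, ofReal_norm_eq]
  exact hC _

/-- The mean value `u ↦ ∫ u q dμ` as a continuous functional on `M^{Φ₁}(q)`. -/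
noncomputable def meanCLM (q : PosDensity μ) : orliczHeart q →L[ℝ] ℝ :=
  (exists_clm_integral q).choose

theorem meanCLM_apply (q : PosDensity μ) (f : orliczHeart q) :
    meanCLM q f = ∫ x, f.1 x ∂q.measure := (exists_clm_integral q).choose_spec f

theorem B_eq_ker (p : PosDensity μ) : B p = LinearMap.ker (meanCLM p).toLinearMap := by
  ext u
  rw [LinearMap.mem_ker, ContinuousLinearMap.coe_coe, meanCLM_apply]
  rfl

instance (p : PosDensity μ) : CompleteSpace (B p) := by
  rw [B_eq_ker]
  exact (meanCLM p).isClosed_ker.completeSpace_coe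

end Orlicz

section Charts

variable {Ω : Type*} [MeasurableSpace Ω] {μ : Measure Ω}

/-! ### Change of the reference density -/

theorem expMap_toFun (p : PosDensity μ) (u : B p) :
    (expMap p u).toFun =ᵐ[μ] fun x => Real.exp (u.1.1 x) / Z p u.1 * p.toFun x :=
  AEEqFun.coeFn_mk _ (aestronglyMeasurable_expDensity p u.1)

theorem PosDensity.eq_of_ae_eq_const_mul {p q : PosDensity μ} {c : ℝ}
    (h : p.toFun =ᵐ[μ] fun x => c * q.toFun x) : p = q := by
  have hc : c = 1 := by
    have h1 := integral_congr_ae h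
    rw [p.integral_eq_one, integral_const_mul, q.integral_eq_one, mul_one] at h1
    exact h1.symm
  refine PosDensity.ext (AEEqFun.ext (h.trans ?_))
  simp [hc]

theorem measure_expMap (p : PosDensity μ) (u : B p) : (expMap p u).measure =
    p.measure.withDensity fun x => ENNReal.ofReal (Real.exp (u.1.1 x) / Z p u.1) := by
  have hm : AEMeasurable (fun x => ENNReal.ofReal (Real.exp (u.1.1 x) / Z p u.1)) μ :=
    ((Real.measurable_exp.comp_aemeasurable u.1.1.aemeasurable).div_const _).ennreal_ofReal
  rw [PosDensity.measure, PosDensity.measure,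
    ← withDensity_mul₀ p.toFun.aemeasurable.ennreal_ofReal hm]
  refine withDensity_congr_ae ?_
  filter_upwards [expMap_toFun p u] with x hx
  rw [hx, Pi.mul_apply,
    ENNReal.ofReal_mul (div_nonneg (Real.exp_pos _).le (Z_pos p u.1).le), mul_comm]

theorem Φ₁_sq_le (x : ℝ) : Φ₁ x ^ 2 ≤ Φ₁ (2 * x) := by
  have h := Real.one_le_cosh x
  have h2 := Real.cosh_sq x
  simp only [Φ₁, Real.cosh_two_mul]
  nlinarith

/-- `M^{Φ₁}(p)` embeds continuously in `M^{Φ₁}(q)` if `q = e_p(u)`: by the inequality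
`e^u Φ₁(f) ≤ e^{2u} + Φ₁(2f)`, and `e^{2u}` is `p`-integrable for every `u` in `M^{Φ₁}(p)`. -/
theorem exists_clm_expMap (p : PosDensity μ) (u : B p) :
    ∃ L : orliczHeart p →L[ℝ] orliczHeart (expMap p u), ∀ f, (L f).1 = f.1 := by
  set q := expMap p u with hq
  have hupm := p.aemeasurable u.1.1
  have hE : ∫⁻ x, ENNReal.ofReal (Real.exp (2 * u.1.1 x)) ∂p.measure < ⊤ := by
    have h1 := (integrable_exp p ((2 : ℝ) • u.1)).hasFiniteIntegral
    rw [hasFiniteIntegral_iff_ofReal (ae_of_all _ fun x => (Real.exp_pos _).le)] at h1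
    refine lt_of_le_of_lt (le_of_eq (lintegral_congr_ae ?_)) h1
    filter_upwards [heart_coe_smul p 2 u.1] with x hx
    rw [hx, Pi.smul_apply, smul_eq_mul]
  have hZ := Z_pos p u.1
  obtain ⟨L, hL⟩ := exists_clm_of_orliczModular_le p q (fun f => f.1)
    (fun f => f.1.aemeasurable) (fun f g => AEEqFun.coeFn_add f.1 g.1)
    (fun k f => AEEqFun.coeFn_smul k f.1) 2 two_pos
    (ENNReal.ofReal (Z p u.1)⁻¹ *
      (1 + ∫⁻ x, ENNReal.ofReal (Real.exp (2 * u.1.1 x)) ∂p.measure))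
    (ENNReal.mul_ne_top ENNReal.ofReal_ne_top
      (ENNReal.add_ne_top.2 ⟨ENNReal.one_ne_top, hE.ne⟩)) (fun f => by
      have hfm := p.aemeasurable f.1
      rw [orliczModular, hq, measure_expMap, lintegral_withDensity_eq_lintegral_mul₀
        (show AEMeasurable (fun x => ENNReal.ofReal (Real.exp (u.1.1 x) / Z p u.1)) _ from
          ((Real.measurable_exp.comp_aemeasurable hupm).div_const _).ennreal_ofReal)
        (measurable_ofReal_Φ₁ hfm)]
      calc _ ≤ ∫⁻ x, ENNReal.ofReal (Z p u.1)⁻¹ * (ENNReal.ofReal (Real.exp (2 * u.1.1 x)) +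
            ENNReal.ofReal (Φ₁ (((2 : ℝ) • (f.1 : Ω → ℝ)) x))) ∂p.measure := by
            refine lintegral_mono fun x => ?_
            rw [Pi.mul_apply, ← ENNReal.ofReal_mul (by positivity),
              ← ENNReal.ofReal_add (Real.exp_pos _).le (Φ₁_nonneg _),
              ← ENNReal.ofReal_mul (by positivity)]
            refine ENNReal.ofReal_le_ofReal ?_
            rw [div_eq_inv_mul, mul_assoc]
            refine mul_le_mul_of_nonneg_left ?_ (by positivity)
            have h1 := Φ₁_sq_le (f.1 x)
            have h2 : Real.exp (2 * u.1.1 x) = Real.exp (u.1.1 x) ^ 2 := by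
              rw [← Real.exp_nat_mul]; norm_num
            rw [Pi.smul_apply, smul_eq_mul, h2]
            nlinarith [sq_nonneg (Real.exp (u.1.1 x) - Φ₁ (f.1 x)),
              sq_nonneg (Real.exp (u.1.1 x)), sq_nonneg (Φ₁ (f.1 x))]
        _ = ENNReal.ofReal (Z p u.1)⁻¹ *
            (∫⁻ x, ENNReal.ofReal (Real.exp (2 * u.1.1 x)) ∂p.measure +
              orliczModular p.measure ((2 : ℝ) • (f.1 : Ω → ℝ))) := by
            have hm : AEMeasurable (fun x => ENNReal.ofReal (Real.exp (2 * u.1.1 x))) p.measure :=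
              (Real.measurable_exp.comp_aemeasurable (hupm.const_mul 2)).ennreal_ofReal
            rw [lintegral_const_mul' _ _ ENNReal.ofReal_ne_top, lintegral_add_left' hm]
            rfl
        _ ≤ _ := by
            rw [mul_assoc]
            gcongr
            rw [add_mul, one_mul, mul_add, mul_one]
            generalize (∫⁻ x, ENNReal.ofReal (Real.exp (2 * u.1.1 x)) ∂p.measure) = a
            generalize orliczModular p.measure ((2 : ℝ) • (f.1 : Ω → ℝ)) = b
            calc a + b ≤ a + b + (1 + a * b) := le_self_add
              _ = _ := by ring)
  exact ⟨L, fun f => AEEqFun.ext (hL f)⟩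

theorem one_mem_orliczHeart (p : PosDensity μ) : (1 : Ω →ₘ[μ] ℝ) ∈ orliczHeart p := by
  rw [mem_orliczHeart_iff]
  intro k _
  have : k • ((1 : Ω →ₘ[μ] ℝ) : Ω → ℝ) =ᵐ[p.measure] fun _ => k := by
    rw [p.ae_measure]
    filter_upwards [AEEqFun.coeFn_one (α := Ω) (β := ℝ) (μ := μ)] with x hx
    simp [hx]
  rw [orliczModular_congr this, orliczModular, lintegral_const, measure_univ, mul_one]
  exact ENNReal.ofReal_lt_top

/-- The constant function one as an element of `M^{Φ₁}(p)`. -/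
def oneHeart (p : PosDensity μ) : orliczHeart p := ⟨1, one_mem_orliczHeart p⟩

theorem meanCLM_oneHeart (p : PosDensity μ) : meanCLM p (oneHeart p) = 1 := by
  have : (oneHeart p).1 =ᵐ[p.measure] fun _ => (1 : ℝ) := by
    rw [p.ae_measure]
    exact AEEqFun.coeFn_one
  rw [meanCLM_apply, integral_congr_ae this]
  simp

/-- The projection `f ↦ f - ∫ f p dμ` of `M^{Φ₁}(p)` onto `B_p`. -/
noncomputable def center (p : PosDensity μ) : orliczHeart p →L[ℝ] B p :=
  (ContinuousLinearMap.id ℝ (orliczHeart p) - (meanCLM p).smulRight (oneHeart p)).codRestrict (B p)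
    fun f => by
      rw [B_eq_ker, LinearMap.mem_ker]
      simp [meanCLM_oneHeart]

theorem coe_center (p : PosDensity μ) (f : orliczHeart p) :
    (center p f : orliczHeart p) = f - meanCLM p f • oneHeart p := rfl

theorem center_coe (p : PosDensity μ) (u : B p) : center p u.1 = u := by
  have : meanCLM p u.1 = 0 := by
    rw [meanCLM_apply]
    exact u.2
  refine Subtype.ext ?_
  rw [coe_center, this, zero_smul, sub_zero]

theorem center_oneHeart (p : PosDensity μ) : center p (oneHeart p) = 0 := by
  refine Subtype.ext ?_
  rw [coe_center, meanCLM_oneHeart, one_smul, sub_self]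
  rfl

theorem expMap_center (p : PosDensity μ) (f : orliczHeart p) :
    ∃ c : ℝ, c ≠ 0 ∧ (expMap p (center p f)).toFun =ᵐ[μ]
      fun x => c * (Real.exp (f.1 x) * p.toFun x) := by
  have hZ := Z_pos p (center p f).1
  refine ⟨Real.exp (-meanCLM p f) / Z p (center p f).1, by positivity, ?_⟩
  filter_upwards [expMap_toFun p (center p f), orliczHeart_coe_sub p f (meanCLM p f • oneHeart p),
    AEEqFun.coeFn_smul (meanCLM p f) (oneHeart p).1,
    AEEqFun.coeFn_one (α := Ω) (β := ℝ) (μ := μ)] with x h1 h2 h3 h4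
  have h3' : (meanCLM p f • oneHeart p).1 x = meanCLM p f * (oneHeart p).1 x := h3
  rw [h1, coe_center, h2, Pi.sub_apply, h3', show (oneHeart p).1 x = 1 from h4, mul_one,
    sub_eq_add_neg, Real.exp_add]
  ring

/-- The continuous inclusion `M^{Φ₁}(p) ⊆ M^{Φ₁}(q)`. -/
def HeartLE (p q : PosDensity μ) : Prop :=
  ∃ L : orliczHeart p →L[ℝ] orliczHeart q, ∀ f, (L f).1 = f.1

theorem HeartLE.trans {p q r : PosDensity μ} (h : HeartLE p q) (h' : HeartLE q r) :
    HeartLE p r := by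
  obtain ⟨L, hL⟩ := h
  obtain ⟨L', hL'⟩ := h'
  exact ⟨L'.comp L, fun f => (hL' _).trans (hL f)⟩

/-- `q = e_p(u)` for some `u` in `B_p`, not necessarily of norm less than one. This is an
equivalence relation. -/
def ExpConnected (p q : PosDensity μ) : Prop := ∃ u : B p, expMap p u = q

theorem expMap_zero (p : PosDensity μ) : expMap p 0 = p := by
  refine PosDensity.eq_of_ae_eq_const_mul (c := (Z p 0)⁻¹) ?_
  filter_upwards [expMap_toFun p 0, AEEqFun.coeFn_zero (β := ℝ) (μ := μ)] with x h1 h2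
  rw [h1, show (((0 : B p) : orliczHeart p).1 : Ω →ₘ[μ] ℝ) x = 0 from h2]
  simp

theorem ExpConnected.refl (p : PosDensity μ) : ExpConnected p p := ⟨0, expMap_zero p⟩

theorem ExpConnected.symm {p q : PosDensity μ} (h : ExpConnected p q) : ExpConnected q p := by
  obtain ⟨u, rfl⟩ := h
  obtain ⟨L, hL⟩ := exists_clm_expMap p u
  obtain ⟨c, hc, h⟩ := expMap_center (expMap p u) (L (-u.1))
  refine ⟨center _ (L (-u.1)), PosDensity.eq_of_ae_eq_const_mul (c := c / Z p u.1) ?_⟩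
  filter_upwards [h, expMap_toFun p u, AEEqFun.coeFn_neg u.1.1] with x h1 h2 h3
  have h3' : (-u.1 : orliczHeart p).1 x = -u.1.1 x := h3
  rw [h1, h2, hL, h3', Real.exp_neg]
  have := Real.exp_pos (u.1.1 x)
  have := Z_pos p u.1
  field_simp

theorem ExpConnected.heartLE {p q : PosDensity μ} (h : ExpConnected p q) : HeartLE p q := by
  obtain ⟨u, rfl⟩ := h
  exact exists_clm_expMap p u

theorem ExpConnected.trans {p q r : PosDensity μ} (h : ExpConnected p q) (h' : ExpConnected q r) :
    ExpConnected p r := by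
  obtain ⟨L, hL⟩ := h.symm.heartLE
  obtain ⟨u, rfl⟩ := h
  obtain ⟨v, rfl⟩ := h'
  obtain ⟨c, hc, h⟩ := expMap_center p (u.1 + L v.1)
  refine ⟨center _ (u.1 + L v.1),
    PosDensity.eq_of_ae_eq_const_mul (c := c * Z p u.1 * Z (expMap p u) v.1) ?_⟩
  filter_upwards [h, expMap_toFun p u, expMap_toFun (expMap p u) v,
    AEEqFun.coeFn_add u.1.1 (L v.1).1] with x h1 h2 h3 h4
  have h4' : (u.1 + L v.1 : orliczHeart p).1 x = u.1.1 x + (L v.1).1 x := h4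
  rw [h1, h3, h2, h4', hL, Real.exp_add]
  have := Z_pos p u.1
  have := Z_pos _ v.1
  field_simp

/-- The transition map between two charts is the restriction of a continuous affine map that is
defined on the whole space, and the corresponding densities agree on the whole space. -/
theorem exists_contDiff_transition {p q : PosDensity μ} {u₀ : B p} {v₀ : B q}
    (h : expMap p u₀ = expMap q v₀) :
    ∃ T : B p → B q, ContDiff ℝ ⊤ T ∧ ∀ u, expMap q (T u) = expMap p u := by
  obtain ⟨L, hL⟩ : HeartLE p q :=
    (ExpConnected.heartLE ⟨u₀, h⟩).trans (ExpConnected.symm ⟨v₀, rfl⟩).heartLE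
  refine ⟨fun u => center q (L (u.1 - u₀.1) + v₀.1), ?_, fun u => ?_⟩
  · have h1 : ContDiff ℝ ⊤ fun u : B p => u.1 := (B p).subtypeL.contDiff
    exact (center q).contDiff.comp ((L.contDiff.comp (h1.sub contDiff_const)).add contDiff_const)
  · obtain ⟨c, hc, hT⟩ := expMap_center q (L (u.1 - u₀.1) + v₀.1)
    have hZp := Z_pos p u.1
    have hZ0 := Z_pos p u₀.1
    have hZq := Z_pos q v₀.1
    refine PosDensity.eq_of_ae_eq_const_mul (c := c * Z q v₀.1 / Z p u₀.1 * Z p u.1) ?_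
    have h0 : (expMap p u₀).toFun =ᵐ[μ] (expMap q v₀).toFun := by rw [h]
    filter_upwards [hT, expMap_toFun p u, h0, expMap_toFun p u₀, expMap_toFun q v₀,
      AEEqFun.coeFn_add (L (u.1 - u₀.1)).1 v₀.1.1, orliczHeart_coe_sub p u.1 u₀.1]
      with x h1 h2 h3 h4 h5 h6 h7
    have h6' : (L (u.1 - u₀.1) + v₀.1 : orliczHeart q).1 x =
      (L (u.1 - u₀.1)).1 x + v₀.1.1 x := h6
    rw [h1, h2, h6', hL, h7, Pi.sub_apply, Real.exp_add, Real.exp_sub]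
    rw [h4, h5] at h3
    have e0 := Real.exp_pos (u₀.1.1 x)
    have h3' : Real.exp (v₀.1.1 x) * q.toFun x =
        Z q v₀.1 / Z p u₀.1 * (Real.exp (u₀.1.1 x) * p.toFun x) := by
      field_simp at h3 ⊢
      linarith
    rw [mul_assoc, h3']
    field_simp

theorem expMap_injective (p : PosDensity μ) : Function.Injective (expMap p) :=
  Function.LeftInverse.injective (logMap_expMap p)

/-! ### The exponential atlas -/

theorem isSmoothAtlas_chart : IsSmoothAtlas (fun p : PosDensity μ => chart p) where
  complete p := inferInstance
  cover := by
    refine eq_univ_of_forall fun p => mem_iUnion.2 ⟨p, 0, ?_, expMap_zero p⟩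
    simp
  isOpen_target p := Metric.isOpen_ball
  isOpen_overlap p q := by
    rw [isOpen_iff_mem_nhds]
    rintro _ ⟨_, ⟨⟨u₀, hu₀, rfl⟩, ⟨v₀, hv₀, h⟩⟩, rfl⟩
    obtain ⟨T, hT, hTe⟩ := exists_contDiff_transition h.symm
    have hTu : T u₀ = v₀ := expMap_injective q ((hTe u₀).trans h.symm)
    have hopen : IsOpen (Metric.ball (0 : B p) 1 ∩ T ⁻¹' Metric.ball 0 1) :=
      Metric.isOpen_ball.inter (Metric.isOpen_ball.preimage hT.continuous)
    refine Filter.mem_of_superset (hopen.mem_nhds (x := logMap p (expMap p u₀)) ?_) ?_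
    · rw [logMap_expMap]
      exact ⟨hu₀, by rwa [mem_preimage, hTu]⟩
    · rintro u ⟨hu, hTu⟩
      exact ⟨expMap p u, ⟨⟨u, hu, rfl⟩, ⟨T u, hTu, hTe u⟩⟩, logMap_expMap p u⟩
  contDiffOn p q := by
    rintro _ ⟨_, ⟨⟨u₀, hu₀, rfl⟩, ⟨v₀, hv₀, h⟩⟩, rfl⟩
    obtain ⟨T, hT, hTe⟩ := exists_contDiff_transition h.symm
    have : (chart q ∘ (chart p).symm) = T := by
      funext u
      change logMap q (expMap p u) = T u
      rw [← hTe u, logMap_expMap]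
    rw [this]
    exact (hT.of_le le_top).contDiffWithinAt

theorem HeartLE.exists_continuousLinearEquiv {p q : PosDensity μ} (h : HeartLE p q)
    (h' : HeartLE q p) : Nonempty (B p ≃L[ℝ] B q) := by
  have key : ∀ {p q : PosDensity μ} (L : orliczHeart p →L[ℝ] orliczHeart q)
      (L' : orliczHeart q →L[ℝ] orliczHeart p) (_ : ∀ f, (L f).1 = f.1)
      (_ : ∀ f, (L' f).1 = f.1) (u : B p), center p (L' (center q (L u.1)).1) = u := by
    intro p q L L' hL hL' u
    have h1 : L' (L u.1) = u.1 := Subtype.ext ((hL' _).trans (hL _))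
    have h2 : L' (oneHeart q) = oneHeart p := Subtype.ext (hL' _)
    rw [coe_center, map_sub, map_sub, map_smul, map_smul, h1, h2, center_oneHeart, smul_zero,
      sub_zero, center_coe]
  obtain ⟨L, hL⟩ := h
  obtain ⟨L', hL'⟩ := h'
  exact ⟨ContinuousLinearEquiv.equivOfInverse ((center q).comp (L.comp (B p).subtypeL))
    ((center p).comp (L'.comp (B q).subtypeL)) (fun u => key L L' hL hL' u)
    (fun u => key L' L hL' hL u)⟩

theorem ExpConnected.exists_continuousLinearEquiv {p q : PosDensity μ} (h : ExpConnected p q) :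
    Nonempty (B p ≃L[ℝ] B q) :=
  h.heartLE.exists_continuousLinearEquiv h.symm.heartLE

end Charts

/-! ### The topology and the manifold structure defined by a smooth atlas -/

section Atlas

open scoped ContDiff Manifold

variable {X ι : Type*} {E : ι → Type*} [∀ i, NormedAddCommGroup (E i)] [∀ i, NormedSpace ℝ (E i)]
  {φ : ∀ i, PartialEquiv X (E i)} [t : TopologicalSpace X]

theorem isOpen_iff_of_atlasTopology (h : IsSmoothAtlas φ) (ht : t = atlasTopology φ) {V : Set X} :
    IsOpen V ↔ ∀ i, IsOpen ((φ i).target ∩ (φ i).symm ⁻¹' V) := by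
  subst ht
  rw [isOpen_iSup_iff]
  refine forall_congr' fun i => ?_
  rw [isOpen_coinduced, (h.isOpen_target i).isOpenEmbedding_subtypeVal.isOpen_iff_image_isOpen]
  have : Subtype.val '' ((fun v : (φ i).target => (φ i).symm v) ⁻¹' V) =
      (φ i).target ∩ (φ i).symm ⁻¹' V := by
    ext v
    constructor
    · rintro ⟨w, hw, rfl⟩
      exact ⟨w.2, hw⟩
    · rintro ⟨h1, h2⟩
      exact ⟨⟨v, h1⟩, h2, rfl⟩
  rw [this]

/-- The charts of a smooth atlas are homeomorphisms for the topology defined by the atlas. -/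
def IsSmoothAtlas.toOpenPartialHomeomorph (h : IsSmoothAtlas φ) (ht : t = atlasTopology φ) (i : ι) :
    OpenPartialHomeomorph X (E i) where
  toPartialEquiv := φ i
  open_target := h.isOpen_target i
  open_source := by
    rw [isOpen_iff_of_atlasTopology h ht]
    intro j
    rw [← PartialEquiv.image_source_inter_eq']
    exact h.isOpen_overlap j i
  continuousOn_toFun := by
    have hs : IsOpen (φ i).source := by
      rw [isOpen_iff_of_atlasTopology h ht]
      intro j
      rw [← PartialEquiv.image_source_inter_eq']
      exact h.isOpen_overlap j i
    refine (continuousOn_open_iff hs).2 fun O hO => ?_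
    rw [isOpen_iff_of_atlasTopology h ht]
    intro j
    rw [preimage_inter, ← inter_assoc, ← PartialEquiv.image_source_inter_eq', ← preimage_comp]
    exact (h.contDiffOn j i).continuousOn.isOpen_inter_preimage (h.isOpen_overlap j i) hO
  continuousOn_invFun := by
    refine (continuousOn_open_iff (h.isOpen_target i)).2 fun O hO => ?_
    exact (isOpen_iff_of_atlasTopology h ht).1 hO i

theorem IsSmoothAtlas.isOpen_source (h : IsSmoothAtlas φ) (ht : t = atlasTopology φ) (i : ι) :
    IsOpen (φ i).source := (h.toOpenPartialHomeomorph ht i).open_source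

theorem IsSmoothAtlas.isPreconnected_source (h : IsSmoothAtlas φ) (ht : t = atlasTopology φ) (i : ι)
    (hc : IsPreconnected (φ i).target) : IsPreconnected (φ i).source := by
  have := hc.image _ (h.toOpenPartialHomeomorph ht i).continuousOn_symm
  rwa [show (h.toOpenPartialHomeomorph ht i).symm '' (φ i).target = (φ i).source from
    (φ i).symm_image_target_eq_source] at this

/-- An open set `C` that contains every chart domain that it meets, and whose charts take their
values in spaces isomorphic to `F`, is a smooth manifold modelled on `F`. -/
theorem IsSmoothAtlas.isModelledOn (h : IsSmoothAtlas φ) (ht : t = atlasTopology φ) {C : Set X}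
    (hC : IsOpen C) (hne : C.Nonempty) (F : Type*) [NormedAddCommGroup F] [NormedSpace ℝ F]
    (hF : ∀ i, ((φ i).source ∩ C).Nonempty → (φ i).source ⊆ C ∧ Nonempty (E i ≃L[ℝ] F)) :
    IsModelledOn φ C F := by
  classical
  have : Nonempty C := hne.to_subtype
  let val : OpenPartialHomeomorph C X :=
    hC.isOpenEmbedding_subtypeVal.toOpenPartialHomeomorph Subtype.val
  let mk (i : ι) (L : E i ≃L[ℝ] F) : OpenPartialHomeomorph C F :=
    (val.trans (h.toOpenPartialHomeomorph ht i)).transHomeomorph L.toHomeomorph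
  have hsource : ∀ i L, (mk i L).source = Subtype.val ⁻¹' (φ i).source := by
    intro i L
    change univ ∩ Subtype.val ⁻¹' (φ i).source = _
    rw [univ_inter]
  have hcoe : ∀ i L x, mk i L x = L (φ i x) := fun i L x => rfl
  have hcov : ∀ x : C, ∃ i, x.1 ∈ (φ i).source := fun x =>
    mem_iUnion.1 (by rw [h.cover]; trivial)
  choose c hc using hcov
  have hL : ∀ x : C, Nonempty (E (c x) ≃L[ℝ] F) := fun x => (hF (c x) ⟨x, hc x, x.2⟩).2
  let cs : ChartedSpace F C :=
    { atlas := {e | ∃ i L, e = mk i L}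
      chartAt := fun x => mk (c x) (hL x).some
      mem_chart_source := fun x => by rw [hsource]; exact hc x
      chart_mem_atlas := fun x => ⟨_, _, rfl⟩ }
  have hatlas : ∀ e ∈ atlas F C, ∃ i L, e = mk i L := fun e he => he
  refine ⟨cs, ?_, fun i hi => ⟨(hF i hi).1, ?_⟩, ?_⟩
  · refine isManifold_of_contDiffOn _ _ _ fun e e' he he' => ?_
    obtain ⟨i, L, rfl⟩ := hatlas e he
    obtain ⟨j, L', rfl⟩ := hatlas e' he'
    simp only [modelWithCornersSelf_coe, modelWithCornersSelf_coe_symm, preimage_id, range_id,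
      inter_univ, Function.id_comp, Function.comp_id]
    -- on its domain the change of charts is `L' ∘ (φ j ∘ (φ i).symm) ∘ L.symm`
    have key : ∀ y ∈ ((mk i L).symm ≫ₕ mk j L').source,
        L.symm y ∈ φ i '' ((φ i).source ∩ (φ j).source) ∧
        ((mk i L).symm ≫ₕ mk j L') y = L' ((φ j ∘ (φ i).symm) (L.symm y)) := by
      intro y hy
      rw [OpenPartialHomeomorph.trans_source] at hy
      have h1 : (mk i L).symm y ∈ (mk i L).source := (mk i L).map_target hy.1
      have h2 : (mk i L).symm y ∈ (mk j L').source := hy.2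
      have h3 : mk i L ((mk i L).symm y) = y := (mk i L).right_inv hy.1
      rw [hsource] at h1 h2
      rw [hcoe] at h3
      have h4 : L.symm y = φ i ((mk i L).symm y).1 := by
        rw [← L.symm_apply_apply (φ i ((mk i L).symm y).1), h3]
      refine ⟨⟨_, ⟨h1, h2⟩, h4.symm⟩, ?_⟩
      rw [h4, Function.comp_apply, (φ i).left_inv h1]
      rfl
    refine ContDiffOn.congr ?_ fun y hy => (key y hy).2
    exact L'.contDiff.comp_contDiffOn
      ((h.contDiffOn i j).comp L.symm.contDiff.contDiffOn fun y hy => (key y hy).1)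
  · obtain ⟨L⟩ := (hF i hi).2
    exact ⟨L, mk i L, ⟨i, L, rfl⟩, hsource i L, fun x _ => hcoe i L x⟩
  · intro e he
    obtain ⟨i, L, rfl⟩ := hatlas e he
    exact ⟨i, L, hsource i L, fun x _ => hcoe i L x⟩

end Atlas

/-! ### The connected components -/

section Components

variable {Ω : Type*} [MeasurableSpace Ω] {μ : Measure Ω}

theorem isOpen_source_chart (p : PosDensity μ) : IsOpen (chart p).source :=
  isSmoothAtlas_chart.isOpen_source rfl p

theorem mem_source_chart (p : PosDensity μ) : p ∈ (chart p).source :=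
  ⟨0, by simp, expMap_zero p⟩

theorem isPreconnected_source_chart (p : PosDensity μ) : IsPreconnected (chart p).source :=
  isSmoothAtlas_chart.isPreconnected_source rfl p (convex_ball (0 : B p) 1).isPreconnected

theorem source_chart_subset_connectedComponent {p q : PosDensity μ}
    (h : ((chart q).source ∩ connectedComponent p).Nonempty) :
    (chart q).source ⊆ connectedComponent p := by
  obtain ⟨r, hr, hrp⟩ := h
  rw [connectedComponent_eq hrp]
  exact (isPreconnected_source_chart q).subset_connectedComponent hr

theorem isOpen_connectedComponent_posDensity (p : PosDensity μ) :
    IsOpen (connectedComponent p) := by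
  rw [isOpen_iff_mem_nhds]
  intro q hq
  exact Filter.mem_of_superset ((isOpen_source_chart q).mem_nhds (mem_source_chart q))
    (source_chart_subset_connectedComponent ⟨q, mem_source_chart q, hq⟩)

theorem expConnected_of_mem_source {p q : PosDensity μ} (h : q ∈ (chart p).source) :
    ExpConnected p q := by
  obtain ⟨u, -, hu⟩ := h
  exact ⟨u, hu⟩

/-- The classes of the relation `ExpConnected` are open, hence closed, so they contain the connected
components. -/
theorem expConnected_of_mem_connectedComponent {p q : PosDensity μ}
    (h : q ∈ connectedComponent p) : ExpConnected p q := by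
  have hclopen : IsClopen {q | ExpConnected p q} := by
    constructor
    · rw [← isOpen_compl_iff, isOpen_iff_mem_nhds]
      intro q hq
      refine Filter.mem_of_superset ((isOpen_source_chart q).mem_nhds (mem_source_chart q)) ?_
      intro r hr hpr
      exact hq (ExpConnected.trans hpr (expConnected_of_mem_source hr).symm)
    · rw [isOpen_iff_mem_nhds]
      intro q hq
      refine Filter.mem_of_superset ((isOpen_source_chart q).mem_nhds (mem_source_chart q)) ?_
      intro r hr
      exact ExpConnected.trans hq (expConnected_of_mem_source hr)
  exact hclopen.connectedComponent_subset (ExpConnected.refl p) h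

theorem isModelledOn_connectedComponent (p : PosDensity μ) :
    IsModelledOn (fun q : PosDensity μ => chart q) (connectedComponent p) (B p) := by
  refine isSmoothAtlas_chart.isModelledOn rfl (isOpen_connectedComponent_posDensity p)
    ⟨p, mem_connectedComponent⟩ (B p) fun q hq => ⟨source_chart_subset_connectedComponent hq, ?_⟩
  obtain ⟨r, hr, hrp⟩ := hq
  exact ((expConnected_of_mem_source hr).trans
    (expConnected_of_mem_connectedComponent hrp).symm).exists_continuousLinearEquiv

end Components

/-! ### Composition operators and conditional expectations -/

section Operators

variable {Ω S : Type*} [mΩ : MeasurableSpace Ω] [mS : MeasurableSpace S] {μ : Measure Ω}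
  {ν : Measure S}

/-- The constant density one of a probability measure `ν`. -/
noncomputable def unitDensity (ν : Measure S) [IsProbabilityMeasure ν] : PosDensity ν where
  toFun := 1
  pos := by
    filter_upwards [AEEqFun.coeFn_one (α := S) (β := ℝ) (μ := ν)] with x hx
    simp [hx]
  integral_eq_one := by
    rw [integral_congr_ae (AEEqFun.coeFn_one (α := S) (β := ℝ) (μ := ν))]
    simp

@[simp]
theorem measure_unitDensity (ν : Measure S) [IsProbabilityMeasure ν] :
    (unitDensity ν).measure = ν := by
  have : (fun x => ENNReal.ofReal ((unitDensity ν).toFun x)) =ᵐ[ν] 1 := by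
    filter_upwards [AEEqFun.coeFn_one (α := S) (β := ℝ) (μ := ν)] with x hx
    simp [unitDensity, hx]
  rw [PosDensity.measure, withDensity_congr_ae this, withDensity_one]

theorem ae_of_map_restrict_le {P : Measure Ω} {ρ : Measure S} {T : Ω → S} (hT : Measurable T)
    {D : Set Ω} (hD : MeasurableSet D) {C : ℝ≥0∞} (hC : (P.restrict D).map T ≤ C • ρ)
    {φ : S → Prop} (h : ∀ᵐ y ∂ρ, φ y) : ∀ᵐ x ∂P, x ∈ D → φ (T x) := by
  rw [← ae_restrict_iff' hD]
  have hac : (P.restrict D).map T ≪ ρ :=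
    (Measure.absolutelyContinuous_of_le hC).trans Measure.smul_absolutelyContinuous
  exact ae_of_ae_map hT.aemeasurable (hac.ae_le h)

/-- The weighted composition operator `g ↦ 1_D · (g ∘ T)` between spaces `M^{Φ₁}`. -/
theorem exists_clm_indicator_comp (p : PosDensity μ) (r : PosDensity ν) {T : Ω → S}
    (hT : Measurable T) {D : Set Ω} (hD : MeasurableSet D) {C : ℝ≥0∞} (hCtop : C ≠ ⊤)
    (hC : (p.measure.restrict D).map T ≤ C • r.measure) :
    ∃ L : orliczHeart r →L[ℝ] orliczHeart p,
      ∀ g, (L g).1 =ᵐ[μ] D.indicator ((g.1 : S → ℝ) ∘ T) := by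
  refine exists_clm_of_orliczModular_le r p (fun g => D.indicator ((g.1 : S → ℝ) ∘ T))
    (fun g => ((g.1.measurable.comp hT).indicator hD).aemeasurable) (fun f g => ?_)
    (fun k f => ?_) 1 one_pos C hCtop (fun g => ?_)
  · rw [← p.ae_measure]
    filter_upwards [ae_of_map_restrict_le hT hD hC (heart_coe_add r f g)] with x hx
    by_cases hxD : x ∈ D
    · simpa [hxD] using hx hxD
    · simp [hxD]
  · rw [← p.ae_measure]
    filter_upwards [ae_of_map_restrict_le hT hD hC (heart_coe_smul r k f)] with x hx
    by_cases hxD : x ∈ D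
    · simpa [hxD] using hx hxD
    · simp [hxD]
  · have hm : Measurable fun y => ENNReal.ofReal (Φ₁ (g.1 y)) :=
      (continuous_Φ₁.measurable.comp g.1.measurable).ennreal_ofReal
    have h1 : orliczModular p.measure (D.indicator ((g.1 : S → ℝ) ∘ T)) =
        ∫⁻ y, ENNReal.ofReal (Φ₁ (g.1 y)) ∂((p.measure.restrict D).map T) := by
      rw [lintegral_map hm hT, ← lintegral_indicator hD, orliczModular]
      refine lintegral_congr fun x => ?_
      by_cases hxD : x ∈ D <;> simp [hxD, Φ₁_zero]
    rw [h1, one_smul]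
    refine (lintegral_mono' hC le_rfl).trans ?_
    rw [lintegral_smul_measure, smul_eq_mul]
    gcongr
    exact le_add_self

theorem convexOn_Φ₁ : ConvexOn ℝ univ Φ₁ := by
  have hd : deriv Φ₁ = Real.sinh := by
    funext x
    exact ((Real.hasDerivAt_cosh x).sub_const 1).deriv
  refine Monotone.convexOn_univ_of_deriv (fun x => ?_) ?_
  · exact ((Real.hasDerivAt_cosh x).sub_const 1).differentiableAt
  · rw [hd]
    exact Real.sinh_strictMono.monotone

theorem integrable_Φ₁ (p : PosDensity μ) (f : orliczHeart p) :
    Integrable (fun x => Φ₁ (f.1 x)) p.measure := by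
  refine ⟨(continuous_Φ₁.measurable.comp_aemeasurable (p.aemeasurable f.1)).aestronglyMeasurable,
    ?_⟩
  rw [hasFiniteIntegral_iff_ofReal (ae_of_all _ fun x => Φ₁_nonneg _)]
  exact orliczModular_lt_top p f

/-- The conditional expectation given `W` on the set `D`, as a function of the value of `W`. -/
theorem exists_clm_condExp (p : PosDensity μ) (r : PosDensity ν) {W : Ω → S} (hW : Measurable W)
    (D : Set Ω) {c : ℝ≥0∞} (hc0 : c ≠ 0) (hctop : c ≠ ⊤)
    (hWr : (p.measure.restrict D).map W = c • r.measure) :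
    ∃ L : orliczHeart p →L[ℝ] orliczHeart r, ∀ f, ((L f).1 : S → ℝ) ∘ W =ᵐ[p.measure.restrict D]
      (p.measure.restrict D)[f.1 | mS.comap W] := by
  have hle : mS.comap W ≤ mΩ := hW.comap_le
  set P := p.measure.restrict D with hP
  -- statements about `S` may be checked after composition with `W`
  have hpull : ∀ φ : S → Prop, (∀ᵐ x ∂P, φ (W x)) → MeasurableSet {y | φ y} → ∀ᵐ y ∂ν, φ y := by
    intro φ h hφ
    have h1 : ∀ᵐ y ∂(P.map W), φ y := (ae_map_iff hW.aemeasurable hφ).2 h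
    rw [hWr, Measure.ae_ennreal_smul_measure_iff hc0] at h1
    rwa [r.ae_measure] at h1
  have hG : ∀ f : orliczHeart p, ∃ G : S → ℝ,
      Measurable G ∧ P[f.1 | mS.comap W] = G ∘ W := fun f =>
    (Measurable.exists_eq_measurable_comp (f := W)
      (stronglyMeasurable_condExp (m := mS.comap W) (μ := P) (f := f.1)).measurable)
  choose G hGm hGe using hG
  have hint : ∀ f : orliczHeart p, Integrable f.1 P := fun f => (integrable_heart p f).restrict
  have hae : ∀ {a b : Ω → ℝ}, a =ᵐ[μ] b → a =ᵐ[P] b := fun h =>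
    ae_restrict_of_ae (p.measure_ac.ae_le h)
  have key : ∃ L : orliczHeart p →L[ℝ] orliczHeart r, ∀ f, (L f).1 =ᵐ[ν] G f := by
    refine exists_clm_of_orliczModular_le p r G (fun f => (hGm f).aemeasurable)
      (fun f g => ?_) (fun k f => ?_) 1 one_pos c⁻¹ (ENNReal.inv_ne_top.2 hc0) (fun f => ?_)
    · refine hpull _ ?_ (measurableSet_eq_fun (hGm _) ((hGm f).add (hGm g)))
      have h1 := condExp_add (hint f) (hint g) (mS.comap W)
      have h2 := condExp_congr_ae (m := mS.comap W) (hae (AEEqFun.coeFn_add f.1 g.1))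
      have h3 := h2.trans h1
      rw [show P[(f.1 + g.1 : Ω →ₘ[μ] ℝ) | mS.comap W] = G (f + g) ∘ W from hGe (f + g), hGe,
        hGe] at h3
      exact h3
    · refine hpull _ ?_ (measurableSet_eq_fun (hGm _) ((hGm f).const_smul k))
      have h1 := condExp_smul (μ := P) k (f.1 : Ω → ℝ) (mS.comap W)
      have h2 := condExp_congr_ae (m := mS.comap W) (hae (AEEqFun.coeFn_smul k f.1))
      have h3 := h2.trans h1
      rw [show P[(k • f.1 : Ω →ₘ[μ] ℝ) | mS.comap W] = G (k • f) ∘ W from hGe (k • f), hGe] at h3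
      exact h3
    · have hΦ : Integrable (Φ₁ ∘ f.1) P := (integrable_Φ₁ p f).restrict
      have hmeas : Measurable fun y => ENNReal.ofReal (Φ₁ (G f y)) :=
        (continuous_Φ₁.measurable.comp (hGm f)).ennreal_ofReal
      have hr : r.measure = c⁻¹ • P.map W := by
        rw [hWr, smul_smul, ENNReal.inv_mul_cancel hc0 hctop, one_smul]
      rw [orliczModular, hr, lintegral_smul_measure, smul_eq_mul, lintegral_map hmeas hW, one_smul]
      gcongr
      refine le_trans ?_ le_add_self
      -- conditional Jensen inequality
      have hJ := ConvexOn.map_condExp_le_univ (m := mS.comap W) (μ := P) hle convexOn_Φ₁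
        continuous_Φ₁.lowerSemicontinuous (hint f) hΦ
      calc ∫⁻ x, ENNReal.ofReal (Φ₁ (G f (W x))) ∂P
          ≤ ∫⁻ x, ENNReal.ofReal (P[Φ₁ ∘ f.1 | mS.comap W] x) ∂P := by
            refine lintegral_mono_ae ?_
            filter_upwards [hJ] with x hx
            rw [hGe] at hx
            exact ENNReal.ofReal_le_ofReal hx
        _ = ENNReal.ofReal (∫ x, P[Φ₁ ∘ f.1 | mS.comap W] x ∂P) := by
            refine (ofReal_integral_eq_lintegral_ofReal integrable_condExp ?_).symm
            filter_upwards [hJ] with x hx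
            exact (Φ₁_nonneg _).trans hx
        _ = ∫⁻ x, ENNReal.ofReal (Φ₁ (f.1 x)) ∂P := by
            rw [integral_condExp hle, ofReal_integral_eq_lintegral_ofReal hΦ
              (ae_of_all _ fun x => Φ₁_nonneg _)]
            rfl
        _ ≤ _ := lintegral_mono' Measure.restrict_le_self le_rfl
  obtain ⟨L, hL⟩ := key
  refine ⟨L, fun f => ?_⟩
  rw [hGe]
  have h1 : (L f).1 =ᵐ[P.map W] G f := by
    rw [hWr]
    refine Measure.ae_smul_measure ?_ c
    rw [r.ae_measure]
    exact hL f
  exact ae_of_ae_map hW.aemeasurable h1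

/-- If `W` maps `p dμ` on `D` to a multiple of `r dν`, then `M^{Φ₁}(r)` is a direct factor of
`M^{Φ₁}(p)`: it embeds by composition with `W`, and conditional expectation is a left inverse. -/
theorem exists_continuousLinearEquiv_prod_ker (p : PosDensity μ) (r : PosDensity ν) {W : Ω → S}
    (hW : Measurable W) {D : Set Ω} (hD : MeasurableSet D) {c : ℝ≥0∞} (hc0 : c ≠ 0) (hctop : c ≠ ⊤)
    (hWr : (p.measure.restrict D).map W = c • r.measure) :
    ∃ K : Submodule ℝ (orliczHeart p), Nonempty (orliczHeart p ≃L[ℝ] orliczHeart r × K) := by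
  obtain ⟨ι, hι⟩ := exists_clm_indicator_comp p r hW hD hctop hWr.le
  obtain ⟨π, hπ⟩ := exists_clm_condExp p r hW D hc0 hctop hWr
  refine ⟨_, ⟨ContinuousLinearEquiv.equivOfRightInverse π ι fun g => ?_⟩⟩
  set P := p.measure.restrict D with hP
  have h1 : (ι g).1 =ᵐ[P] (g.1 : S → ℝ) ∘ W := by
    filter_upwards [ae_restrict_of_ae (p.measure_ac.ae_le (hι g)), ae_restrict_mem hD] with x hx hxD
    rw [hx, indicator_of_mem hxD]
  have h2 : ((π (ι g)).1 : S → ℝ) ∘ W =ᵐ[P] (g.1 : S → ℝ) ∘ W := by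
    refine (hπ (ι g)).trans ((condExp_congr_ae h1).trans ?_)
    rw [condExp_of_stronglyMeasurable hW.comap_le]
    · exact (g.1.measurable.comp (comap_measurable W)).stronglyMeasurable
    · exact ((integrable_heart p (ι g)).restrict).congr h1
  refine orliczHeart_ext ?_
  have h3 : (π (ι g)).1 =ᵐ[P.map W] g.1 :=
    (ae_map_iff hW.aemeasurable (measurableSet_eq_fun (π (ι g)).1.measurable g.1.measurable)).2 h2
  rw [hWr] at h3
  rw [← r.ae_measure]
  exact (Measure.ae_ennreal_smul_measure_iff hc0).1 h3

end Operators

/-! ### Countably many copies of a probability space -/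

section Shift

variable {S : Type*} [MeasurableSpace S]

/-- The measure on `ℕ × S` whose restriction to the copy `{k} × S` of `S` is `2⁻ᵏ⁻¹ ρ`. -/
noncomputable def geomProd (ρ : Measure S) : Measure (ℕ × S) :=
  Measure.sum fun k => ((2 : ℝ≥0∞)⁻¹ ^ (k + 1)) • ρ.map (Prod.mk k)

theorem geomProd_apply (ρ : Measure S) {A : Set (ℕ × S)} (hA : MeasurableSet A) :
    geomProd ρ A = ∑' k : ℕ, (2 : ℝ≥0∞)⁻¹ ^ (k + 1) * ρ (Prod.mk k ⁻¹' A) := by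
  rw [geomProd, Measure.sum_apply _ hA]
  refine tsum_congr fun k => ?_
  rw [Measure.smul_apply, Measure.map_apply measurable_prodMk_left hA, smul_eq_mul]

instance (ρ : Measure S) [IsProbabilityMeasure ρ] : IsProbabilityMeasure (geomProd ρ) := by
  refine ⟨?_⟩
  rw [geomProd_apply _ MeasurableSet.univ]
  simp only [preimage_univ, measure_univ, mul_one]
  rw [ENNReal.tsum_geometric_add_one, ENNReal.one_sub_inv_two, inv_inv]
  exact ENNReal.inv_mul_cancel two_ne_zero ENNReal.ofNat_ne_top

theorem map_mk_zero_le (ρ : Measure S) : ρ.map (Prod.mk 0) ≤ (2 : ℝ≥0∞) • geomProd ρ := by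
  refine Measure.le_iff.2 fun A hA => ?_
  rw [Measure.map_apply measurable_prodMk_left hA, Measure.smul_apply, smul_eq_mul,
    geomProd_apply ρ hA]
  refine le_trans (le_of_eq ?_) (mul_le_mul_right (ENNReal.le_tsum 0) 2)
  rw [zero_add, pow_one, ← mul_assoc, ENNReal.mul_inv_cancel two_ne_zero ENNReal.ofNat_ne_top,
    one_mul]

theorem measurable_succ_prod : Measurable fun y : ℕ × S => (y.1 + 1, y.2) :=
  (measurable_fst.add_const 1).prodMk measurable_snd

theorem measurable_pred_prod : Measurable fun y : ℕ × S => (y.1 - 1, y.2) :=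
  (measurable_fst.sub_const 1).prodMk measurable_snd

theorem map_succ_geomProd_le (ρ : Measure S) :
    (geomProd ρ).map (fun y => (y.1 + 1, y.2)) ≤ (2 : ℝ≥0∞) • geomProd ρ := by
  refine Measure.le_iff.2 fun A hA => ?_
  rw [Measure.map_apply measurable_succ_prod hA, Measure.smul_apply, smul_eq_mul,
    geomProd_apply ρ hA, geomProd_apply ρ (measurable_succ_prod hA), ← ENNReal.tsum_mul_left]
  refine le_trans (le_of_eq (tsum_congr fun k => ?_)) (ENNReal.tsum_comp_le_tsum_of_injective
    (add_left_injective 1) fun k : ℕ => 2 * ((2 : ℝ≥0∞)⁻¹ ^ (k + 1) * ρ (Prod.mk k ⁻¹' A)))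
  rw [pow_succ' _ (k + 1), ← mul_assoc, ← mul_assoc, ENNReal.mul_inv_cancel two_ne_zero
    ENNReal.ofNat_ne_top, one_mul]
  rfl

theorem map_snd_geomProd_restrict_le (ρ : Measure S) (D : Set (ℕ × S)) :
    ((geomProd ρ).restrict D).map Prod.snd ≤ (1 : ℝ≥0∞) • ρ := by
  refine (Measure.map_mono Measure.restrict_le_self measurable_snd).trans ?_
  refine Measure.le_iff.2 fun A hA => ?_
  rw [Measure.map_apply measurable_snd hA, geomProd_apply ρ (measurable_snd hA), one_smul]
  have : ∀ k : ℕ, Prod.mk k ⁻¹' (Prod.snd ⁻¹' A) = A := fun k => rfl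
  simp_rw [this]
  rw [ENNReal.tsum_mul_right, ENNReal.tsum_geometric_add_one, ENNReal.one_sub_inv_two, inv_inv,
    ENNReal.inv_mul_cancel two_ne_zero ENNReal.ofNat_ne_top, one_mul]

theorem map_pred_geomProd_restrict_le (ρ : Measure S) :
    ((geomProd ρ).restrict {y | y.1 ≠ 0}).map (fun y => (y.1 - 1, y.2)) ≤
      (1 : ℝ≥0∞) • geomProd ρ := by
  have hD : MeasurableSet {y : ℕ × S | y.1 ≠ 0} :=
    (measurable_fst (measurableSet_singleton 0)).compl
  refine Measure.le_iff.2 fun A hA => ?_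
  rw [Measure.map_apply measurable_pred_prod hA, Measure.restrict_apply (measurable_pred_prod hA),
    one_smul, geomProd_apply ρ hA, geomProd_apply ρ ((measurable_pred_prod hA).inter hD),
    tsum_eq_zero_add' ENNReal.summable]
  have h0 : Prod.mk 0 ⁻¹' ((fun y : ℕ × S => (y.1 - 1, y.2)) ⁻¹' A ∩ {y | y.1 ≠ 0}) = ∅ := by
    ext x; simp
  rw [h0, measure_empty, mul_zero, zero_add]
  refine ENNReal.tsum_le_tsum fun k => ?_
  refine mul_le_mul' ?_ (measure_mono fun x hx => hx.1)
  exact pow_le_pow_of_le_one zero_le (ENNReal.inv_le_one.2 one_le_two) (by omega)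

/-- Since `ℕ × S` is the union of `{0} × S` and of a copy of itself, the space `M^{Φ₁}` over
`ℕ × S` absorbs the one over `S`. The weights of consecutive copies of `S` have the ratio `2`, so
that the shift is bounded. -/
theorem nonempty_heart_geomProd_equiv (ρ : Measure S) [IsProbabilityMeasure ρ] :
    Nonempty (orliczHeart (unitDensity (geomProd ρ)) ≃L[ℝ]
      orliczHeart (unitDensity ρ) × orliczHeart (unitDensity (geomProd ρ))) := by
  have hD0 : MeasurableSet {y : ℕ × S | y.1 = 0} := measurable_fst (measurableSet_singleton 0)
  have hD1 : MeasurableSet {y : ℕ × S | y.1 ≠ 0} := hD0.compl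
  have hz : ((unitDensity ρ).measure.restrict univ).map (Prod.mk 0) ≤
      (2 : ℝ≥0∞) • (unitDensity (geomProd ρ)).measure := by
    simpa using map_mk_zero_le ρ
  have hs : ((unitDensity (geomProd ρ)).measure.restrict univ).map (fun y => (y.1 + 1, y.2)) ≤
      (2 : ℝ≥0∞) • (unitDensity (geomProd ρ)).measure := by
    simpa using map_succ_geomProd_le ρ
  have hsnd : ((unitDensity (geomProd ρ)).measure.restrict {y | y.1 = 0}).map Prod.snd ≤
      (1 : ℝ≥0∞) • (unitDensity ρ).measure := by
    simpa only [measure_unitDensity] using map_snd_geomProd_restrict_le ρ _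
  have hp : ((unitDensity (geomProd ρ)).measure.restrict {y | y.1 ≠ 0}).map
      (fun y => (y.1 - 1, y.2)) ≤ (1 : ℝ≥0∞) • (unitDensity (geomProd ρ)).measure := by
    simpa only [measure_unitDensity] using map_pred_geomProd_restrict_le ρ
  obtain ⟨R₀, hR₀⟩ := exists_clm_indicator_comp _ _ (measurable_prodMk_left (x := 0))
    MeasurableSet.univ ENNReal.ofNat_ne_top hz
  obtain ⟨R₁, hR₁⟩ := exists_clm_indicator_comp _ _ measurable_succ_prod
    MeasurableSet.univ ENNReal.ofNat_ne_top hs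
  obtain ⟨J₀, hJ₀⟩ := exists_clm_indicator_comp _ _ measurable_snd hD0 ENNReal.one_ne_top hsnd
  obtain ⟨J₁, hJ₁⟩ := exists_clm_indicator_comp _ _ measurable_pred_prod hD1 ENNReal.one_ne_top hp
  -- the inverse pastes a function on `S` and a shifted function on `ℕ × S` together
  have hJ : ∀ a G, ∀ᵐ y ∂(geomProd ρ), (J₀ a + J₁ G).1 y =
      if y.1 = 0 then a.1 y.2 else G.1 (y.1 - 1, y.2) := by
    intro a G
    filter_upwards [hJ₀ a, hJ₁ G, AEEqFun.coeFn_add (J₀ a).1 (J₁ G).1] with y h0 h1 h2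
    rw [show (J₀ a + J₁ G).1 y = (J₀ a).1 y + (J₁ G).1 y from h2, h0, h1]
    by_cases h : y.1 = 0 <;> simp [h]
  refine ⟨ContinuousLinearEquiv.equivOfInverse (R₀.prod R₁) (J₀.coprod J₁) (fun G => ?_) ?_⟩
  · refine orliczHeart_ext ?_
    have h0 := ae_of_map_restrict_le measurable_snd hD0 hsnd
      (φ := fun x => (R₀ G).1 x = G.1 (0, x)) (by
        rw [measure_unitDensity]
        filter_upwards [hR₀ G] with x hx
        simpa using hx)
    have h1 := ae_of_map_restrict_le measurable_pred_prod hD1 hp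
      (φ := fun y => (R₁ G).1 y = G.1 (y.1 + 1, y.2)) (by
        rw [measure_unitDensity]
        filter_upwards [hR₁ G] with x hx
        simpa using hx)
    rw [measure_unitDensity] at h0 h1
    filter_upwards [hJ (R₀ G) (R₁ G), h0, h1] with y hy h0 h1
    refine Eq.trans hy ?_
    obtain ⟨k, x⟩ := y
    by_cases h : k = 0
    · subst h
      simpa using h0
    · have h1' := h1 h
      simp only [Nat.sub_add_cancel (Nat.one_le_iff_ne_zero.2 h)] at h1'
      simpa [h] using h1'
  · rintro ⟨a, G⟩
    refine Prod.ext (orliczHeart_ext ?_) (orliczHeart_ext ?_)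
    · have h := ae_of_map_restrict_le (measurable_prodMk_left (x := 0)) MeasurableSet.univ hz
        (by rw [measure_unitDensity]; exact hJ a G)
      rw [measure_unitDensity] at h
      filter_upwards [h, hR₀ (J₀ a + J₁ G)] with x h1 h2
      refine Eq.trans h2 ?_
      simpa using h1
    · have h := ae_of_map_restrict_le measurable_succ_prod MeasurableSet.univ hs
        (by rw [measure_unitDensity]; exact hJ a G)
      rw [measure_unitDensity] at h
      filter_upwards [h, hR₁ (J₀ a + J₁ G)] with x h1 h2
      refine Eq.trans h2 ?_
      simpa using h1

end Shift

/-! ### Separable measures -/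

section Separable

variable {Ω : Type*} [MeasurableSpace Ω] {μ : Measure Ω}

/-- A set of finite measure is, up to a null set, a limit superior of sets of a measure-dense
sequence. -/
theorem exists_ae_eq_preimage_of_ne_top {F : Ω → ℝ} {t : ℕ → Set Ω} {b : ℕ → Set ℝ}
    (hb : ∀ n, MeasurableSet (b n)) (htb : ∀ n, t n = F ⁻¹' b n)
    (hd : μ.MeasureDense (range t)) {A : Set Ω} (hA : MeasurableSet A) (hμA : μ A ≠ ⊤) :
    ∃ b' : Set ℝ, MeasurableSet b' ∧ A =ᵐ[μ] F ⁻¹' b' := by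
  have : ∀ k : ℕ, ∃ n, μ (symmDiff A (t n)) < ENNReal.ofReal ((1 / 2) ^ k) := by
    intro k
    obtain ⟨_, ⟨n, rfl⟩, h⟩ := hd.approx A hA hμA ((1 / 2) ^ k) (by positivity)
    exact ⟨n, h⟩
  choose n hn using this
  have hsum : ∑' k, μ {x | x ∈ symmDiff A (t (n k))} ≠ ⊤ := by
    refine ne_top_of_le_ne_top ?_ (ENNReal.tsum_le_tsum fun k => (hn k).le)
    exact summable_geometric_two.tsum_ofReal_ne_top
  have hae : ∀ᵐ x ∂μ, ∀ᶠ k in Filter.atTop, x ∉ symmDiff A (t (n k)) :=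
    ae_eventually_notMem hsum
  refine ⟨Filter.limsup (fun k => b (n k)) Filter.atTop,
    MeasurableSet.measurableSet_limsup fun k => hb _, ?_⟩
  filter_upwards [hae] with x hx
  refine propext ?_
  have h1 : x ∈ F ⁻¹' Filter.limsup (fun k => b (n k)) Filter.atTop ↔
      ∃ᶠ k in Filter.atTop, x ∈ t (n k) := by
    simp only [htb, mem_preimage, Filter.mem_limsup_iff_frequently_mem]
  refine Iff.trans ?_ h1.symm
  have h2 : ∀ᶠ k in Filter.atTop, (x ∈ A ↔ x ∈ t (n k)) := by
    filter_upwards [hx] with k hk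
    rw [mem_symmDiff] at hk
    tauto
  constructor
  · intro hxA
    exact (h2.mono fun k hk => hk.1 hxA).frequently
  · intro h
    obtain ⟨k, hk, hk'⟩ := (h.and_eventually h2).exists
    exact hk'.2 hk

/-- On a separable measure space that carries a positive density there is a real random variable
that generates the `σ`-algebra up to null sets. -/
theorem exists_measurable_generating (p : PosDensity μ) (hsep : IsSeparable μ) :
    ∃ F : Ω → ℝ, Measurable F ∧
      ∀ A, MeasurableSet A → ∃ b : Set ℝ, MeasurableSet b ∧ A =ᵐ[μ] F ⁻¹' b := by
  classical
  obtain ⟨𝒜, h𝒜c, h𝒜⟩ := hsep.exists_countable_measureDense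
  obtain ⟨t, rfl⟩ := h𝒜c.exists_eq_range h𝒜.nonempty
  obtain ⟨e, he⟩ := exists_measurableEmbedding_real (ℕ → Bool)
  have ht : ∀ n, MeasurableSet (t n) := fun n => h𝒜.measurable _ ⟨n, rfl⟩
  let F : Ω → ℝ := fun x => e fun n => decide (x ∈ t n)
  have hF : Measurable F := by
    refine he.measurable.comp (measurable_pi_lambda _ fun n => measurable_to_bool ?_)
    convert ht n using 1
    ext x
    simp
  have htb : ∀ n, t n = F ⁻¹' (e '' {w | w n = true}) := by
    intro n
    ext x
    simp [F, he.injective.eq_iff]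
  have hb : ∀ n, MeasurableSet (e '' {w : ℕ → Bool | w n = true}) := fun n =>
    he.measurableSet_image.2
      (show MeasurableSet ((fun w : ℕ → Bool => w n) ⁻¹' {true}) from
        measurable_pi_apply n (measurableSet_singleton true))
  refine ⟨F, hF, fun A hA => ?_⟩
  -- exhaust `A` by sets on which the density is bounded below
  let A' : ℕ → Set Ω := fun k => A ∩ {x | 1 / ((k : ℝ) + 1) ≤ p.toFun x}
  have hA'm : ∀ k, MeasurableSet (A' k) := fun k =>
    hA.inter (measurableSet_le measurable_const p.toFun.measurable)
  have hA' : ∀ k, ∃ b : Set ℝ, MeasurableSet b ∧ A' k =ᵐ[μ] F ⁻¹' b := by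
    intro k
    refine exists_ae_eq_preimage_of_ne_top hb htb h𝒜 (hA'm k) ?_
    refine ne_top_of_le_ne_top (p.integrable.measure_norm_ge_lt_top
      (by positivity : (0 : ℝ) < 1 / ((k : ℝ) + 1))).ne (measure_mono ?_)
    rintro x ⟨-, hx⟩
    have hx' : 1 / ((k : ℝ) + 1) ≤ p.toFun x := hx
    exact hx'.trans (le_abs_self _)
  choose b hbm hbe using hA'
  refine ⟨⋃ k, b k, MeasurableSet.iUnion hbm, ?_⟩
  rw [preimage_iUnion]
  refine Filter.EventuallyEq.trans ?_ (Filter.EventuallyEq.countable_iUnion hbe)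
  filter_upwards [p.pos] with x hx
  refine propext ⟨fun hxA => ?_, fun hxA => ?_⟩
  · obtain ⟨k, hk⟩ := exists_nat_one_div_lt hx
    exact mem_iUnion.2 ⟨k, hxA, hk.le⟩
  · obtain ⟨k, hk⟩ := mem_iUnion.1 hxA
    exact hk.1

theorem exists_ae_eq_comp_of_generating {F : Ω → ℝ}
    (hF : ∀ A, MeasurableSet A → ∃ b : Set ℝ, MeasurableSet b ∧ A =ᵐ[μ] F ⁻¹' b) {f : Ω → ℝ}
    (hf : Measurable f) : ∃ g : ℝ → ℝ, Measurable g ∧ f =ᵐ[μ] g ∘ F := by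
  have hsimple : ∀ s : SimpleFunc Ω ℝ, ∃ g : ℝ → ℝ, Measurable g ∧ s =ᵐ[μ] g ∘ F := by
    intro s
    induction s using SimpleFunc.induction with
    | const c hA =>
      rename_i A
      obtain ⟨b, hb, hAb⟩ := hF A hA
      refine ⟨b.indicator fun _ => c, measurable_const.indicator hb, ?_⟩
      have h1 := indicator_ae_eq_of_ae_eq_set (f := fun _ : Ω => c) hAb
      have h2 : (SimpleFunc.piecewise A hA (SimpleFunc.const Ω c) (SimpleFunc.const Ω 0) : Ω → ℝ) =
          A.indicator fun _ => c := by
        rw [SimpleFunc.coe_piecewise]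
        simp only [SimpleFunc.coe_const, Function.const_zero, Set.piecewise_eq_indicator]
        rfl
      rw [h2]
      exact h1
    | add hd h1 h2 =>
      obtain ⟨g1, hg1, e1⟩ := h1
      obtain ⟨g2, hg2, e2⟩ := h2
      exact ⟨g1 + g2, hg1.add hg2, e1.add e2⟩
  choose g hg hge using fun n => hsimple (hf.stronglyMeasurable.approx n)
  -- where the sequence `g n` does not converge, the value of its `limsup` does not matter
  refine ⟨fun y => Filter.limsup (fun n => g n y) Filter.atTop, Measurable.limsup hg, ?_⟩
  filter_upwards [ae_all_iff.2 hge] with x hx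
  have h1 := hf.stronglyMeasurable.tendsto_approx x
  have h2 : (fun n => g n (F x)) = fun n => hf.stronglyMeasurable.approx n x :=
    funext fun n => (hx n).symm
  rw [Function.comp_apply, h2]
  exact h1.limsup_eq.symm

/-- Composition with a generating random variable identifies `M^{Φ₁}(p)` with the space `M^{Φ₁}` of
its distribution. -/
theorem nonempty_heart_map_equiv (p : PosDensity μ) {F : Ω → ℝ} (hFm : Measurable F)
    (hF : ∀ A, MeasurableSet A → ∃ b : Set ℝ, MeasurableSet b ∧ A =ᵐ[μ] F ⁻¹' b)
    (ρ : Measure ℝ) [IsProbabilityMeasure ρ] (hρ : p.measure.map F = ρ) :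
    Nonempty (orliczHeart (unitDensity ρ) ≃L[ℝ] orliczHeart p) := by
  have hle : (p.measure.restrict univ).map F ≤ (1 : ℝ≥0∞) • (unitDensity ρ).measure := by
    rw [Measure.restrict_univ, hρ, one_smul, measure_unitDensity]
  obtain ⟨L, hL⟩ := exists_clm_indicator_comp p (unitDensity ρ) hFm MeasurableSet.univ
    ENNReal.one_ne_top hle
  have hL' : ∀ g, (L g).1 =ᵐ[μ] (g.1 : ℝ → ℝ) ∘ F := fun g => by simpa using hL g
  have hinj : Function.Injective L := by
    intro g g' h
    refine orliczHeart_ext ?_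
    have h1 : (g.1 : ℝ → ℝ) ∘ F =ᵐ[μ] (g'.1 : ℝ → ℝ) ∘ F := by
      refine (hL' g).symm.trans ?_
      rw [h]
      exact hL' g'
    have h2 : g.1 =ᵐ[p.measure.map F] g'.1 := (ae_map_iff hFm.aemeasurable
      (measurableSet_eq_fun g.1.measurable g'.1.measurable)).2 (p.measure_ac.ae_le h1)
    exact hρ ▸ h2
  have hsurj : Function.Surjective L := by
    intro f
    obtain ⟨g, hg, hfg⟩ := exists_ae_eq_comp_of_generating hF f.1.measurable
    have hmem : AEEqFun.mk g hg.aestronglyMeasurable ∈ orliczHeart (unitDensity ρ) := by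
      rw [mem_orliczHeart_iff]
      intro k hk
      have h1 : k • (AEEqFun.mk g hg.aestronglyMeasurable : ℝ → ℝ) =ᵐ[ρ] k • g :=
        (AEEqFun.coeFn_mk g hg.aestronglyMeasurable).const_smul k
      have h2 : Measurable fun y => ENNReal.ofReal (Φ₁ ((k • g) y)) :=
        (continuous_Φ₁.measurable.comp (hg.const_smul k)).ennreal_ofReal
      rw [measure_unitDensity, orliczModular_congr h1, orliczModular, ← hρ, lintegral_map h2 hFm]
      refine lt_of_le_of_lt (le_of_eq ?_) (mem_orliczHeart_iff.1 f.2 k hk)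
      refine lintegral_congr_ae (p.measure_ac.ae_le ?_)
      filter_upwards [hfg] with x hx
      simp [hx]
    refine ⟨⟨_, hmem⟩, orliczHeart_ext ?_⟩
    refine (hL' _).trans (Filter.EventuallyEq.trans ?_ hfg.symm)
    have h2 : (AEEqFun.mk (μ := ρ) g hg.aestronglyMeasurable : ℝ → ℝ) =ᵐ[p.measure.map F] g := by
      rw [hρ]
      exact AEEqFun.coeFn_mk g hg.aestronglyMeasurable
    exact p.ac_measure.ae_le (ae_of_ae_map hFm.aemeasurable h2)
  exact ⟨ContinuousLinearEquiv.ofBijective L (LinearMap.ker_eq_bot.2 hinj)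
    (LinearMap.range_eq_top.2 hsurj)⟩

end Separable

/-! ### Diffuse measures -/

section Diffuse

open ProbabilityTheory

theorem continuous_cdf_of_noAtoms (ρ : Measure ℝ) [IsProbabilityMeasure ρ]
    (h : ∀ y, ρ {y} = 0) : Continuous (cdf ρ) := by
  rw [continuous_iff_continuousAt]
  intro y
  rw [(monotone_cdf ρ).continuousAt_iff_leftLim_eq_rightLim, StieltjesFunction.rightLim_eq]
  have h1 := h y
  rw [← measure_cdf ρ, StieltjesFunction.measure_singleton, ENNReal.ofReal_eq_zero] at h1
  exact le_antisymm ((monotone_cdf ρ).leftLim_le le_rfl) (by linarith)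

/-- The distribution function of a probability measure without point masses is uniformly
distributed. -/
theorem exists_map_eq_volume_unitInterval (ρ : Measure ℝ) [IsProbabilityMeasure ρ]
    (h : ∀ y, ρ {y} = 0) :
    ∃ U : ℝ → unitInterval, Measurable U ∧ ρ.map U = volume := by
  have hcont := continuous_cdf_of_noAtoms ρ h
  let U : ℝ → unitInterval := fun x => ⟨cdf ρ x, cdf_nonneg ρ x, cdf_le_one ρ x⟩
  have hU : Measurable U := (hcont.subtype_mk _).measurable
  refine ⟨U, hU, ?_⟩
  have : IsProbabilityMeasure (ρ.map U) := Measure.isProbabilityMeasure_map hU.aemeasurable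
  have hrange : ∀ a : ℝ, 0 < a → a < 1 → ∃ y, cdf ρ y = a := by
    intro a h0 h1
    refine mem_range_of_exists_le_of_exists_ge hcont ?_ ?_
    · exact (((tendsto_cdf_atBot ρ).eventually (gt_mem_nhds h0)).exists).imp fun _ h => h.le
    · exact (((tendsto_cdf_atTop ρ).eventually (lt_mem_nhds h1)).exists).imp fun _ h => h.le
  refine Measure.ext_of_Iic _ _ fun a => ?_
  rw [unitInterval.volume_Iic, Measure.map_apply hU measurableSet_Iic]
  have hpre : U ⁻¹' Iic a = {x | cdf ρ x ≤ a} := rfl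
  rw [hpre]
  refine le_antisymm ?_ ?_
  · rcases a.2.2.lt_or_eq with h1 | h1
    · -- compare with the values of the distribution function slightly above `a`
      refine ENNReal.le_of_forall_pos_le_add fun ε hε _ => ?_
      obtain ⟨b, hab, hb⟩ := exists_between (lt_min h1 (lt_add_of_pos_right a.1 hε))
      obtain ⟨y, hy⟩ := hrange b (a.2.1.trans_lt hab) (hb.trans_le (min_le_left _ _))
      have hsub : {x | cdf ρ x ≤ a} ⊆ Iic y := by
        intro x hx
        by_contra hxy
        have hx' : cdf ρ x ≤ a := hx
        have := monotone_cdf ρ (not_le.1 hxy).le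
        linarith
      refine (measure_mono hsub).trans ?_
      rw [← ofReal_cdf, hy, ← ENNReal.ofReal_coe_nnreal, ← ENNReal.ofReal_add a.2.1 ε.coe_nonneg]
      exact ENNReal.ofReal_le_ofReal (hb.le.trans (min_le_right _ _))
    · rw [h1, ENNReal.ofReal_one]
      exact prob_le_one
  · rcases a.2.1.eq_or_lt with h0 | h0
    · rw [← h0, ENNReal.ofReal_zero]
      exact zero_le
    · rcases a.2.2.lt_or_eq with h1 | h1
      · obtain ⟨y, hy⟩ := hrange a h0 h1
        rw [← hy, ofReal_cdf]
        exact measure_mono fun x hx => monotone_cdf ρ hx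
      · have : {x | cdf ρ x ≤ a} = univ := eq_univ_of_forall fun x => by
          rw [mem_ofPred_eq, h1]
          exact cdf_le_one ρ x
        rw [this, measure_univ, h1, ENNReal.ofReal_one]

variable {Ω : Type*} [MeasurableSpace Ω] {μ : Measure Ω}

/-- A generating random variable has no point masses on a diffuse set: up to null sets, the
measurable subsets of one of its fibres are null or the whole fibre. -/
theorem measure_inter_preimage_singleton_of_isDiffuseOn {F : Ω → ℝ} (hFm : Measurable F)
    (hF : ∀ A, MeasurableSet A → ∃ b : Set ℝ, MeasurableSet b ∧ A =ᵐ[μ] F ⁻¹' b) {D : Set Ω}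
    (hD : MeasurableSet D) (hdiff : IsDiffuseOn μ D) (y : ℝ) : μ (F ⁻¹' {y} ∩ D) = 0 := by
  by_contra h
  obtain ⟨A', hA'sub, hA', hpos, hpos'⟩ := hdiff (F ⁻¹' {y} ∩ D) inter_subset_right
    ((hFm (measurableSet_singleton y)).inter hD) (pos_iff_ne_zero.2 h)
  obtain ⟨b, -, hb⟩ := hF A' hA'
  by_cases hy : y ∈ b
  · refine hpos'.ne' (measure_mono_null ?_ (ae_le_set.1 hb.symm.le))
    rintro x ⟨⟨hx, -⟩, hxA⟩
    refine ⟨?_, hxA⟩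
    rw [mem_preimage, mem_singleton_iff] at hx
    rwa [mem_preimage, hx]
  · refine hpos.ne' (measure_mono_null ?_ (ae_le_set.1 hb.le))
    intro x hx
    refine ⟨hx, fun hxb => hy ?_⟩
    have h1 := (hA'sub hx).1
    rw [mem_preimage, mem_singleton_iff] at h1
    rwa [mem_preimage, h1] at hxb

/-- On a diffuse set there are random variables with any prescribed distribution. -/
theorem exists_map_restrict_eq_smul (p : PosDensity μ) {F : Ω → ℝ} (hFm : Measurable F)
    (hF : ∀ A, MeasurableSet A → ∃ b : Set ℝ, MeasurableSet b ∧ A =ᵐ[μ] F ⁻¹' b) {D : Set Ω}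
    (hD : MeasurableSet D) (hpos : 0 < μ D) (hdiff : IsDiffuseOn μ D)
    {S : Type*} [MeasurableSpace S] [StandardBorelSpace S] (ρ : Measure S)
    [IsProbabilityMeasure ρ] :
    ∃ W : Ω → S, Measurable W ∧ (p.measure.restrict D).map W = p.measure D • ρ := by
  have hS : Nonempty S := nonempty_of_isProbabilityMeasure ρ
  have hc0 : p.measure D ≠ 0 := fun h => hpos.ne' (p.ac_measure h)
  have hctop : p.measure D ≠ ⊤ := measure_ne_top _ _
  set c := p.measure D with hc
  let σ : Measure ℝ := c⁻¹ • (p.measure.restrict D).map F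
  have hσ : IsProbabilityMeasure σ := by
    refine ⟨?_⟩
    rw [Measure.smul_apply, Measure.map_apply hFm MeasurableSet.univ, preimage_univ,
      Measure.restrict_apply_univ, smul_eq_mul, ENNReal.inv_mul_cancel hc0 hctop]
  have hσ0 : ∀ y, σ {y} = 0 := by
    intro y
    rw [Measure.smul_apply, Measure.map_apply hFm (measurableSet_singleton y),
      Measure.restrict_apply (hFm (measurableSet_singleton y)),
      p.measure_ac (measure_inter_preimage_singleton_of_isDiffuseOn hFm hF hD hdiff y), smul_zero]
  obtain ⟨U, hU, hUσ⟩ := exists_map_eq_volume_unitInterval σ hσ0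
  obtain ⟨V, hV, hVρ⟩ := Measure.exists_measurable_map_eq ρ
  refine ⟨V ∘ U ∘ F, hV.comp (hU.comp hFm), ?_⟩
  have h1 : (p.measure.restrict D).map F = c • σ := by
    rw [smul_smul, ENNReal.mul_inv_cancel hc0 hctop, one_smul]
  rw [← Measure.map_map hV (hU.comp hFm), ← Measure.map_map hU hFm, h1, Measure.map_smul,
    Measure.map_smul, hUσ, hVρ]

end Diffuse

/-! ### Hyperplanes -/

section Hyperplane

variable {E F : Type*} [NormedAddCommGroup E] [NormedSpace ℝ E] [NormedAddCommGroup F]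
  [NormedSpace ℝ F]

/-- For an isomorphism `e` of `ℝ × E` onto `ℝ × F`, the map of `E` to `F` that projects the image of
the hyperplane `{0} × E` onto the hyperplane `{0} × F` along the vector `e x`. -/
noncomputable def hyperplaneProj (e : (ℝ × E) ≃L[ℝ] ℝ × F) (x : ℝ × E) : E →L[ℝ] F :=
  (ContinuousLinearMap.snd ℝ ℝ F).comp
    ((e : (ℝ × E) →L[ℝ] ℝ × F).comp (ContinuousLinearMap.inr ℝ ℝ E) -
      ((e x).1⁻¹ • (ContinuousLinearMap.fst ℝ ℝ F).comp
        ((e : (ℝ × E) →L[ℝ] ℝ × F).comp (ContinuousLinearMap.inr ℝ ℝ E))).smulRight (e x))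

theorem hyperplaneProj_apply (e : (ℝ × E) ≃L[ℝ] ℝ × F) (x : ℝ × E) (u : E) :
    hyperplaneProj e x u = (e (0, u)).2 - ((e x).1⁻¹ * (e (0, u)).1) • (e x).2 := rfl

theorem hyperplaneProj_symm_apply (e : (ℝ × E) ≃L[ℝ] ℝ × F) {x : ℝ × E} (hx : x.1 ≠ 0)
    (hex : (e x).1 ≠ 0) (u : E) : hyperplaneProj e.symm (e x) (hyperplaneProj e x u) = u := by
  set k := (e x).1⁻¹ * (e (0, u)).1 with hk
  have h1 : e ((0, u) - k • x) = (0, hyperplaneProj e x u) := by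
    rw [map_sub, map_smul]
    refine Prod.ext ?_ rfl
    simp only [Prod.fst_sub, Prod.smul_fst, smul_eq_mul, hk]
    field_simp
    ring
  have h2 : e.symm (0, hyperplaneProj e x u) = (0, u) - k • x := by
    rw [← h1, e.symm_apply_apply]
  rw [hyperplaneProj_apply e.symm, h2, e.symm_apply_apply]
  have h3 : x.1⁻¹ * ((0, u) - k • x).1 = -k := by
    simp only [Prod.fst_sub, Prod.smul_fst, smul_eq_mul]
    field_simp
    ring
  rw [h3]
  simp

/-- A line can be cancelled: `{0} × E` and the preimage of `{0} × F` are closed hyperplanes of the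
same space, and each projects isomorphically onto the other along a vector that lies in neither. -/
theorem nonempty_equiv_of_real_prod_equiv (e : (ℝ × E) ≃L[ℝ] ℝ × F) : Nonempty (E ≃L[ℝ] F) := by
  obtain ⟨x, hx, hex⟩ : ∃ x : ℝ × E, x.1 ≠ 0 ∧ (e x).1 ≠ 0 := by
    by_cases h1 : (e (1, 0)).1 = 0
    · by_cases h2 : (e.symm (1, 0)).1 = 0
      · refine ⟨(1, 0) + e.symm (1, 0), ?_, ?_⟩
        · simp [h2]
        · simp [h1]
      · exact ⟨e.symm (1, 0), h2, by simp⟩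
    · exact ⟨(1, 0), by simp, h1⟩
  refine ⟨ContinuousLinearEquiv.equivOfInverse (hyperplaneProj e x) (hyperplaneProj e.symm (e x))
    (hyperplaneProj_symm_apply e hx hex) fun v => ?_⟩
  have := hyperplaneProj_symm_apply e.symm (x := e x) hex (by simpa using hx) v
  rwa [e.symm_symm, e.symm_apply_apply] at this

variable {Ω : Type*} [MeasurableSpace Ω] {μ : Measure Ω}

/-- `M^{Φ₁}(p)` is the sum of the constants and of `B_p`. -/
theorem nonempty_orliczHeart_equiv_prod_B (p : PosDensity μ) :
    Nonempty (orliczHeart p ≃L[ℝ] ℝ × B p) := by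
  refine ⟨ContinuousLinearEquiv.equivOfInverse ((meanCLM p).prod (center p))
    (((ContinuousLinearMap.id ℝ ℝ).smulRight (oneHeart p)).coprod (B p).subtypeL)
    (fun f => ?_) ?_⟩
  · simp [coe_center]
  · rintro ⟨a, u⟩
    have hu : meanCLM p u.1 = 0 := by
      rw [meanCLM_apply]
      exact u.2
    refine Prod.ext ?_ ?_
    · simp [meanCLM_oneHeart, hu]
    · simp [center_oneHeart, center_coe]

end Hyperplane

/-! ### The isomorphism of the spaces `B_p` -/

section Separable

variable {Ω : Type*} [MeasurableSpace Ω] {μ : Measure Ω}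

/-- `M^{Φ₁}(p)` absorbs `M^{Φ₁}(q)`: the diffuse set is the union of countably many parts with
geometric weights, each carrying a copy of the distribution of a generating random variable under
`q`, and shifting these copies makes room for one more. -/
theorem nonempty_orliczHeart_equiv_prod (hsep : IsSeparable μ) {D : Set Ω} (hD : MeasurableSet D)
    (hpos : 0 < μ D) (hdiff : IsDiffuseOn μ D) (p q : PosDensity μ) :
    Nonempty (orliczHeart p ≃L[ℝ] orliczHeart q × orliczHeart p) := by
  obtain ⟨F, hFm, hF⟩ := exists_measurable_generating p hsep
  set ρ := q.measure.map F with hρ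
  have : IsProbabilityMeasure ρ := Measure.isProbabilityMeasure_map hFm.aemeasurable
  obtain ⟨W, hW, hWρ⟩ := exists_map_restrict_eq_smul p hFm hF hD hpos hdiff (geomProd ρ)
  obtain ⟨K, ⟨e₁⟩⟩ := exists_continuousLinearEquiv_prod_ker p (unitDensity (geomProd ρ)) hW hD
    (c := p.measure D) (fun h => hpos.ne' (p.ac_measure h)) (measure_ne_top _ _)
    (by rwa [measure_unitDensity])
  obtain ⟨e₂⟩ := nonempty_heart_geomProd_equiv ρ
  obtain ⟨e₃⟩ := nonempty_heart_map_equiv q hFm hF ρ hρ.symm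
  exact ⟨((e₁.trans (e₂.prodCongr (.refl ℝ K))).trans (.prodAssoc ℝ _ _ _)).trans
    (e₃.prodCongr e₁.symm)⟩

theorem nonempty_B_equiv (hsep : IsSeparable μ) {D : Set Ω} (hD : MeasurableSet D)
    (hpos : 0 < μ D) (hdiff : IsDiffuseOn μ D) (p q : PosDensity μ) :
    Nonempty (B q ≃L[ℝ] B p) := by
  obtain ⟨e₁⟩ := nonempty_orliczHeart_equiv_prod hsep hD hpos hdiff p q
  obtain ⟨e₂⟩ := nonempty_orliczHeart_equiv_prod hsep hD hpos hdiff q p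
  obtain ⟨e₃⟩ := nonempty_orliczHeart_equiv_prod_B p
  obtain ⟨e₄⟩ := nonempty_orliczHeart_equiv_prod_B q
  exact nonempty_equiv_of_real_prod_equiv (e₄.symm.trans
    ((e₂.trans ((ContinuousLinearEquiv.prodComm ℝ _ _).trans e₁.symm)).trans e₃))

end Separable

end InfoGeom


theorem mainTheorem4 {Ω : Type*} [MeasurableSpace Ω] (μ : MeasureTheory.Measure Ω) :
    InfoGeom.IsSmoothAtlas (fun p : InfoGeom.PosDensity μ => InfoGeom.chart p) ∧
    (∀ p : InfoGeom.PosDensity μ, IsOpen (connectedComponent p) ∧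
      InfoGeom.IsModelledOn (fun q : InfoGeom.PosDensity μ => InfoGeom.chart q)
        (connectedComponent p) (InfoGeom.B p)) ∧
    (MeasureTheory.IsSeparable μ →
      (∃ D : Set Ω, MeasurableSet D ∧ 0 < μ D ∧ InfoGeom.IsDiffuseOn μ D) →
      ∀ p : InfoGeom.PosDensity μ,
        (∀ q : InfoGeom.PosDensity μ, Nonempty (InfoGeom.B q ≃L[ℝ] InfoGeom.B p)) ∧
        InfoGeom.IsModelledOn (fun q : InfoGeom.PosDensity μ => InfoGeom.chart q)
          Set.univ (InfoGeom.B p)) := by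
  refine ⟨InfoGeom.isSmoothAtlas_chart, fun p => ⟨InfoGeom.isOpen_connectedComponent_posDensity p,
    InfoGeom.isModelledOn_connectedComponent p⟩, ?_⟩
  rintro hsep ⟨D, hD, hpos, hdiff⟩ p
  have hB := InfoGeom.nonempty_B_equiv hsep hD hpos hdiff p
  exact ⟨hB, InfoGeom.isSmoothAtlas_chart.isModelledOn rfl isOpen_univ ⟨p, trivial⟩ (InfoGeom.B p)
    fun q _ => ⟨Set.subset_univ _, hB q⟩⟩
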